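/- Let $\Omega\subset\mathbb{R}^2$ be a Jordan domain, i.e. a bounded domain whose boundary is a Jordan curve, and let $\alpha\in(0,1)$. Put $$\Sigma(\Omega,t^{\alpha})=\{(x,z)\in\mathbb{R}^2\times\mathbb{R}\colon x\in\overline{\Omega},\ z=\pm\,\mathrm{dist}(x,\partial\Omega)^{\alpha}\}$$ with the Euclidean metric of $\mathbb{R}^3$. Suppose that: * $\Omega$ has the level quasicircle (LQC) property: there exist $\epsilon_0>0$ and $K\ge 1$ such that for every $\epsilon\in[0,\epsilon_0]$ the level set $\gamma_\epsilon=\{x\in\overline{\Omega}\colon \mathrm{dist}(x,\partial\Omega)=\epsilon\}$ is a $K$-quasicircle, i.e. the image of the unit circle under a $K$-quasiconformal homeomorphism of $\mathbb{R}^2$; * $\Sigma(\Omega,t^{\alpha})$ is quasisymmetric to the unit sphere $\mathbb{S}^2\subset\mathbb{R}^3$: there are a homeomorphism $f$ of $\Sigma(\Omega,t^{\alpha})$ onto $\mathbb{S}^2$ and a homeomorphism $\eta\colon[0,\infty)\to[0,\infty)$ such that, for all $x,a,b\in\Sigma(\Omega,t^\alpha)$ and $t>0$, $|x-a|\le t|x-b|$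 implies $|f(x)-f(a)|\le\eta(t)|f(x)-f(b)|$. Then $\partial\Omega$ is a weak chord-arc curve. That is, there exists $M_0>0$ such that every subarc $\Gamma'\subset\partial\Omega$ with $\mathrm{diam}\,\Gamma'<1$ can be written as the union of a finite set $\mathscr{P}$ of subarcs, mutually disjoint except for their endpoints, with $$\tfrac12(\mathrm{diam}\,\Gamma')^2\le\mathrm{diam}\,A\le(\mathrm{diam}\,\Gamma')^2\quad\text{for every }A\in\mathscr{P},\qquad \frac{1}{\mathrm{diam}\,\Gamma'}\sum_{A\in\mathscr{P}}\mathrm{diam}\,A\le M_0 .$$ -/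

import Mathlib

open scoped ENNReal NNReal

noncomputable section

namespace DoubleDome

/-- The Euclidean plane. -/
abbrev Plane : Type := EuclideanSpace ℝ (Fin 2)

/-- Euclidean three-space. -/
abbrev Space : Type := EuclideanSpace ℝ (Fin 3)

/-! ### Jordan curves, Jordan arcs, Jordan domains -/

/-- A Jordan curve: a homeomorphic image of the circle, i.e. (the circle being compact)
the image of the circle under a continuous injection. -/
def IsJordanCurve (Γ : Set Plane) : Prop :=
  ∃ g : Circle → Plane, Continuous g ∧ Function.Injective g ∧ Set.range g = Γ

/-- `A` is a (closed, non-degenerate) Jordan arc with endpoints `x` and `y`. -/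
def IsArcFromTo (A : Set Plane) (x y : Plane) : Prop :=
  ∃ g : unitInterval → Plane,
    Continuous g ∧ Function.Injective g ∧ Set.range g = A ∧ g 0 = x ∧ g 1 = y

/-- A Jordan arc. The subarcs of a Jordan curve or arc `Γ` are the Jordan arcs contained
in `Γ`. -/
def IsJordanArc (A : Set Plane) : Prop := ∃ x y, IsArcFromTo A x y

/-- The set of the two endpoints of a Jordan arc. -/
def arcEndpoints (A : Set Plane) : Set Plane := {x | ∃ y, IsArcFromTo A x y}

/-- A planar Jordan domain: a bounded domain whose boundary is a Jordan curve. -/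
def IsJordanDomain (Ω : Set Plane) : Prop :=
  IsOpen Ω ∧ IsConnected Ω ∧ Bornology.IsBounded Ω ∧ IsJordanCurve (frontier Ω)

/-! ### Plane quasiconformal maps (geometric definition) and quasicircles -/

/-- A (closed) path in the plane. -/
abbrev PlanePath : Type := C(unitInterval, Plane)

/-- A path is rectifiable when its length is finite. -/
def IsRectifiable (γ : PlanePath) : Prop := eVariationOn γ Set.univ ≠ ∞

/-- The line integral `∫_γ ρ ds` along a rectifiable path `γ`: the integral of `ρ` along the
arc-length parametrization of `γ`, over the interval from `0` to the length of `γ`. -/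
def lineIntegral (ρ : Plane → ℝ≥0∞) (γ : PlanePath) : ℝ≥0∞ :=
  ∫⁻ s in Set.Icc (0 : ℝ) (eVariationOn γ Set.univ).toReal,
    ρ (naturalParameterization γ Set.univ 0 s)

/-- `ρ` is admissible for the path family `F`: it is a Borel function with `∫_γ ρ ds ≥ 1` for
every rectifiable `γ ∈ F`. -/
def IsAdmissible (F : Set PlanePath) (ρ : Plane → ℝ≥0∞) : Prop :=
  Measurable ρ ∧ ∀ γ ∈ F, IsRectifiable γ → 1 ≤ lineIntegral ρ γ

/-- The conformal modulus of a path family in the plane. -/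
def modulus (F : Set PlanePath) : ℝ≥0∞ :=
  ⨅ (ρ : Plane → ℝ≥0∞) (_ : IsAdmissible F ρ), ∫⁻ x, ρ x ^ 2

/-- The image of a path family under a homeomorphism of the plane. -/
def mapFamily (f : Plane ≃ₜ Plane) (F : Set PlanePath) : Set PlanePath :=
  (fun γ : PlanePath => (f : C(Plane, Plane)).comp γ) '' F

/-- A homeomorphism `f` of the plane is `K`-quasiconformal if
`K⁻¹ M(F) ≤ M(f F) ≤ K M(F)` for every path family `F`. -/
def IsQuasiconformal (K : ℝ) (f : Plane ≃ₜ Plane) : Prop :=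
  1 ≤ K ∧ ∀ F : Set PlanePath,
    modulus F ≤ ENNReal.ofReal K * modulus (mapFamily f F) ∧
    modulus (mapFamily f F) ≤ ENNReal.ofReal K * modulus F

/-- A `K`-quasicircle: the image of the unit circle under a `K`-quasiconformal homeomorphism of
the plane. -/
def IsQuasicircle (K : ℝ) (Γ : Set Plane) : Prop :=
  ∃ f : Plane ≃ₜ Plane, IsQuasiconformal K f ∧ f '' Metric.sphere (0 : Plane) 1 = Γ

/-! ### Level sets, the LQC property, and the double-dome-like surface -/

/-- The level set `γ_ε = {x ∈ closure Ω : dist (x, ∂Ω) = ε}`. -/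
def levelSet (Ω : Set Plane) (ε : ℝ) : Set Plane :=
  {x | x ∈ closure Ω ∧ Metric.infDist x (frontier Ω) = ε}

/-- The level quasicircle property: all level sets at small heights (including `ε = 0`) are
`K`-quasicircles with one and the same `K`. -/
def HasLQC (Ω : Set Plane) : Prop :=
  ∃ ε₀ > (0 : ℝ), ∃ K : ℝ, 1 ≤ K ∧ ∀ ε : ℝ, 0 ≤ ε → ε ≤ ε₀ → IsQuasicircle K (levelSet Ω ε)

/-- The surface `Σ(Ω, t^α) = {(x, z) : x ∈ closure Ω, z = ± dist (x, ∂Ω) ^ α}` in three-space. -/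
def surface (Ω : Set Plane) (α : ℝ) : Set Space :=
  {p | ∃ x ∈ closure Ω, p 0 = x 0 ∧ p 1 = x 1 ∧
    (p 2 = Metric.infDist x (frontier Ω) ^ α ∨ p 2 = -(Metric.infDist x (frontier Ω) ^ α))}

/-! ### Quasisymmetry -/

/-- Two metric spaces are quasisymmetric if there is an `η`-quasisymmetric homeomorphism from the
first onto the second, for some self-homeomorphism `η` of `[0, ∞)`. -/
def IsQuasisymmetricTo (X Y : Type*) [MetricSpace X] [MetricSpace Y] : Prop :=
  ∃ (f : X ≃ₜ Y) (η : ℝ≥0 ≃ₜ ℝ≥0), ∀ (x a b : X) (t : ℝ≥0), 0 < t →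
    dist x a ≤ t * dist x b → dist (f x) (f a) ≤ η t * dist (f x) (f b)

/-! ### Partitions and the weak chord-arc property -/

/-- A partition of a Jordan curve or arc `Γ`: a finite set of subarcs, mutually disjoint except
for their endpoints, whose union is `Γ`. -/
def IsPartition (Γ : Set Plane) (P : Finset (Set Plane)) : Prop :=
  (∀ A ∈ P, IsJordanArc A) ∧
  (∀ A ∈ P, ∀ B ∈ P, A ≠ B → A ∩ B ⊆ arcEndpoints A ∩ arcEndpoints B) ∧
  (⋃ A ∈ P, A) = Γ

/-- A `δ`-partition: every piece has diameter between `(δ/2) diam Γ` and `δ diam Γ`. -/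
def IsDeltaPartition (δ : ℝ) (Γ : Set Plane) (P : Finset (Set Plane)) : Prop :=
  IsPartition Γ P ∧
  ∀ A ∈ P, δ / 2 * Metric.diam Γ ≤ Metric.diam A ∧ Metric.diam A ≤ δ * Metric.diam Γ

/-- `M(Γ, P) = (diam Γ)⁻¹ ∑_{A ∈ P} diam A`. -/
def chordArcIndex (Γ : Set Plane) (P : Finset (Set Plane)) : ℝ :=
  (1 / Metric.diam Γ) * ∑ A ∈ P, Metric.diam A

/-- The weak chord-arc property: for some `M₀`, every subarc `Γ'` of diameter less than `1` has a
`diam Γ'`-partition `P` with `M(Γ', P) ≤ M₀`. -/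
def IsWeakChordArc (Γ : Set Plane) : Prop :=
  ∃ M₀ > (0 : ℝ), ∀ Γ' : Set Plane, IsJordanArc Γ' → Γ' ⊆ Γ → Metric.diam Γ' < 1 →
    ∃ P : Finset (Set Plane),
      IsDeltaPartition (Metric.diam Γ') Γ' P ∧ chordArcIndex Γ' P ≤ M₀

end DoubleDome

end

open Set Filter Topology MeasureTheory

namespace DoubleDome

/-! ### Arc length of rectifiable paths -/

/-! Along an inward normal at a boundary point the surface reaches height `r` after a horizontal
displacement of only `r ^ (1 / α)`, which is far less than `r` for small `r` because `α < 1`. A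
family of `δ`-separated boundary points in a disc of radius `r` thus carries a family of separated,
nearly vertical columns of height `r`. A quasisymmetric sphere has no room for too many of them: a
length-area argument on the sphere (`exists_card_chains_le`) bounds the number of columns by a
constant times the number of steps in one column. This gives at most `C r / δ` points, provided `δ`
is at least a constant times `r ^ (1 / α)` (`exists_separationBound`).

The restriction on `δ` is then relaxed by working on two scales: exponents multiply under
`SeparationBound.comp`, and since `1 / α > 1` some power exceeds `3`. Cut a subarc of diameter `d <
1` into pieces of diameter comparable to `d ^ 2` (`exists_cuts`). The cut points are separated by a
multiple of `d ^ 2` (`le_dist_of_cuts`), so for small `d` there are at most a constant times `1 / d`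
pieces, which is the weak chord-arc bound; large `d` is handled by compactness.

The level set at height `0` is the boundary itself, so the boundary is a quasicircle. From the
modulus definition only weak quasisymmetry is extracted (`IsQuasiconformal.weak_quasisymmetric`), by
playing the lower bound `le_modulus_joining` against the upper bound `modulus_crossing_le`. It
serves twice: it yields corkscrew points, hence normals of sufficient length (`exists_corkscrew`,
`exists_normal_segment`), and it separates the cut points. -/

/-- The length of the initial piece of a path. -/
noncomputable def arcLength (γ : PlanePath) : unitInterval → ℝ := variationOnFromTo γ univ 0

theorem IsRectifiable.locallyBounded {γ : PlanePath} (h : IsRectifiable γ) :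
    LocallyBoundedVariationOn γ univ :=
  BoundedVariationOn.locallyBoundedVariationOn h

theorem arcLength_zero (γ : PlanePath) : arcLength γ 0 = 0 := variationOnFromTo.self _ _ _

theorem arcLength_one (γ : PlanePath) :
    arcLength γ 1 = (eVariationOn γ univ).toReal := by
  have hI : (univ : Set unitInterval) ∩ Icc 0 1 = univ := by
    ext u; simp [unitInterval.le_one']
  rw [arcLength, variationOnFromTo.eq_of_le _ _ (by simp : (0 : unitInterval) ≤ 1), hI]

theorem arcLength_sub {γ : PlanePath} (h : IsRectifiable γ) {u v : unitInterval} (huv : u ≤ v) :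
    arcLength γ v - arcLength γ u = (eVariationOn γ (univ ∩ Icc u v)).toReal := by
  have := variationOnFromTo.add h.locallyBounded (mem_univ 0) (mem_univ u) (mem_univ v)
  rw [← variationOnFromTo.eq_of_le _ _ huv]
  simp only [arcLength]
  linarith

theorem arcLength_monotone {γ : PlanePath} (h : IsRectifiable γ) : Monotone (arcLength γ) := by
  intro u v huv
  have := arcLength_sub h huv
  have h0 : 0 ≤ (eVariationOn γ (univ ∩ Icc u v)).toReal := ENNReal.toReal_nonneg
  linarith

theorem dist_le_arcLength_sub {γ : PlanePath} (h : IsRectifiable γ) {u v : unitInterval}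
    (huv : u ≤ v) : dist (γ u) (γ v) ≤ arcLength γ v - arcLength γ u := by
  rw [arcLength_sub h huv]
  have hb : BoundedVariationOn γ (univ ∩ Icc u v) := BoundedVariationOn.mono h inter_subset_left
  exact hb.dist_le ⟨mem_univ _, le_rfl, huv⟩ ⟨mem_univ _, huv, le_rfl⟩

/-- The variation function jumps at a point exactly as much as the path does, and the path is
continuous. -/
theorem continuous_arcLength {γ : PlanePath} (h : IsRectifiable γ) : Continuous (arcLength γ) := by
  rw [continuous_iff_continuousAt]
  intro b
  have hc : Tendsto γ (𝓝 b) (𝓝 (γ b)) := γ.continuous.continuousAt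
  have hl := variationOnFromTo.tendsto_left (mem_univ 0) (mem_univ b) h.locallyBounded
    (hc.mono_left (nhdsWithin_le_nhds (s := univ ∩ Iio b)))
  have hr := variationOnFromTo.tendsto_right (mem_univ 0) (mem_univ b) h.locallyBounded
    (hc.mono_left (nhdsWithin_le_nhds (s := univ ∩ Ioi b)))
  simp only [univ_inter, dist_self, sub_zero, add_zero] at hl hr
  rw [continuousAt_iff_continuous_left'_right']
  exact ⟨hl, hr⟩

theorem surjOn_arcLength {γ : PlanePath} (h : IsRectifiable γ) :
    Icc 0 (eVariationOn γ univ).toReal ⊆ range (arcLength γ) := by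
  have := intermediate_value_univ (0 : unitInterval) 1 (continuous_arcLength h)
  rwa [arcLength_zero, arcLength_one] at this

theorem naturalParameterization_arcLength {γ : PlanePath} (h : IsRectifiable γ)
    (u : unitInterval) : naturalParameterization γ univ 0 (arcLength γ u) = γ u :=
  edist_eq_zero.1 (edist_naturalParameterization_eq_zero h.locallyBounded (mem_univ 0) (mem_univ u))

theorem lipschitzOnWith_naturalParameterization {γ : PlanePath} (h : IsRectifiable γ) :
    LipschitzOnWith 1 (naturalParameterization γ univ 0)
      (Icc 0 (eVariationOn γ univ).toReal) := by
  refine LipschitzOnWith.of_dist_le_mul fun s hs t ht => ?_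
  obtain ⟨u, rfl⟩ := surjOn_arcLength h hs
  obtain ⟨v, rfl⟩ := surjOn_arcLength h ht
  rw [naturalParameterization_arcLength h, naturalParameterization_arcLength h, NNReal.coe_one,
    one_mul]
  rcases le_total u v with huv | huv
  · rw [dist_comm (arcLength γ u), Real.dist_eq]
    exact (dist_le_arcLength_sub h huv).trans (le_abs_self _)
  · rw [dist_comm, Real.dist_eq]
    exact (dist_le_arcLength_sub h huv).trans (le_abs_self _)

/-- A `1`-Lipschitz real function does not increase Lebesgue measure. -/
theorem volume_image_le_of_lipschitzOnWith {f : ℝ → ℝ} {s : Set ℝ} (h : LipschitzOnWith 1 f s) :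
    volume (f '' s) ≤ volume s := by
  have := h.hausdorffMeasure_image_le zero_le_one
  simpa [hausdorffMeasure_real] using this

/-- The path `u ↦ σ (T u)` obtained from a Lipschitz curve `σ`. -/
noncomputable def pathOf (σ : ℝ → Plane) (hσ : LipschitzWith 1 σ) (T : ℝ) : PlanePath :=
  ⟨fun u => σ (T * u), hσ.continuous.comp (by fun_prop)⟩

theorem eVariationOn_pathOf_le {σ : ℝ → Plane} (hσ : LipschitzWith 1 σ) {T : ℝ} (hT : 0 ≤ T)
    {u v : unitInterval} (huv : u ≤ v) :
    eVariationOn (pathOf σ hσ T) (univ ∩ Icc u v) ≤ ENNReal.ofReal (T * v - T * u) := by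
  have h1 := (hσ.lipschitzOnWith (s := univ)).comp_eVariationOn_le
    (f := σ) (g := fun w : unitInterval => T * (w : ℝ)) (s := univ ∩ Icc u v) (mapsTo_univ _ _)
  have hm : MonotoneOn (fun w : unitInterval => T * (w : ℝ)) (univ ∩ Icc u v) :=
    fun a _ b _ hab => mul_le_mul_of_nonneg_left hab hT
  have h2 := (hm.eVariationOn_eq ⟨mem_univ u, le_rfl, huv⟩ ⟨mem_univ v, huv, le_rfl⟩).le
  rw [ENNReal.coe_one, one_mul] at h1
  refine le_trans h1 (le_trans ?_ h2)
  exact eVariationOn.mono _ (fun w hw => ⟨hw, hw.2⟩)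

theorem isRectifiable_pathOf {σ : ℝ → Plane} (hσ : LipschitzWith 1 σ) {T : ℝ} (hT : 0 ≤ T) :
    IsRectifiable (pathOf σ hσ T) := by
  have hI : (univ : Set unitInterval) ∩ Icc 0 1 = univ := by
    ext u; simp [unitInterval.le_one']
  have := eVariationOn_pathOf_le hσ hT (u := 0) (v := 1) (by simp)
  rw [hI] at this
  exact ne_top_of_le_ne_top ENNReal.ofReal_ne_top this

/-- The line integral along a Lipschitz curve is at most the integral over the parameter. -/
theorem lineIntegral_pathOf_le {σ : ℝ → Plane} (hσ : LipschitzWith 1 σ) {T : ℝ} (hT : 0 ≤ T)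
    (ρ : Plane → ℝ≥0∞) :
    lineIntegral ρ (pathOf σ hσ T) ≤ ∫⁻ s in Icc 0 T, ρ (σ s) := by
  rcases hT.eq_or_lt with rfl | hT
  · have h0 : eVariationOn (pathOf σ hσ 0) univ = 0 :=
      eVariationOn.constant_on (by rintro _ ⟨u, -, rfl⟩ _ ⟨v, -, rfl⟩; simp [pathOf])
    simp [lineIntegral, h0]
  set γ := pathOf σ hσ T with hγ
  have hr : IsRectifiable γ := isRectifiable_pathOf hσ hT.le
  let q : ℝ → unitInterval := fun s => projIcc 0 1 zero_le_one (s / T)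
  -- Arc length as a function of the parameter of `σ`. It is `1`-Lipschitz and onto `[0, ℓ]`, so
  -- Lebesgue measure on `[0, ℓ]` is dominated by the push-forward of Lebesgue measure on `[0, T]`.
  let lam : ℝ → ℝ := fun s => arcLength γ (q s)
  have hqm : Monotone q := fun s t hst =>
    monotone_projIcc _ (div_le_div_of_nonneg_right hst hT.le)
  have hlam : LipschitzWith 1 lam := by
    refine LipschitzWith.of_le_add fun s t => ?_
    rcases le_total s t with hst | hst
    · exact (arcLength_monotone hr (hqm hst)).trans (by linarith [dist_nonneg (x := s) (y := t)])
    · have h1 := arcLength_sub hr (hqm hst)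
      have h2 := eVariationOn_pathOf_le hσ hT.le (hqm hst)
      have h3 : (T : ℝ) * (q s : ℝ) - T * (q t : ℝ) ≤ dist s t := by
        have h4 : |(q s : ℝ) - q t| ≤ |s / T - t / T| := abs_projIcc_sub_projIcc zero_le_one
        rw [Real.dist_eq]
        calc T * (q s : ℝ) - T * q t ≤ T * |(q s : ℝ) - q t| := by
              rw [← mul_sub]; exact mul_le_mul_of_nonneg_left (le_abs_self _) hT.le
          _ ≤ T * |s / T - t / T| := mul_le_mul_of_nonneg_left h4 hT.le
          _ = |s - t| := by
              rw [← sub_div, abs_div, abs_of_pos hT]; field_simp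
      have h5 : (eVariationOn γ (univ ∩ Icc (q t) (q s))).toReal ≤ T * (q s : ℝ) - T * q t := by
        refine ENNReal.toReal_le_of_le_ofReal ?_ h2
        have : (q t : ℝ) ≤ q s := hqm hst
        nlinarith
      show arcLength γ (q s) ≤ arcLength γ (q t) + dist s t
      linarith
  have hq0 : ∀ u : unitInterval, q (T * u) = u := fun u => by
    simp only [q]
    rw [mul_div_cancel_left₀ _ hT.ne']
    exact projIcc_val _ u
  set ℓ := (eVariationOn γ univ).toReal with hℓ
  have hmeas : (volume.restrict (Icc 0 ℓ)) ≤ Measure.map lam (volume.restrict (Icc 0 T)) := by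
    refine Measure.le_iff.2 fun B hB => ?_
    rw [Measure.map_apply hlam.continuous.measurable hB, Measure.restrict_apply hB,
      Measure.restrict_apply (hlam.continuous.measurable hB)]
    refine le_trans (measure_mono ?_)
      (volume_image_le_of_lipschitzOnWith (hlam.lipschitzOnWith (s := lam ⁻¹' B ∩ Icc 0 T)))
    rintro y ⟨hy, hy2⟩
    obtain ⟨u, rfl⟩ := surjOn_arcLength hr hy2
    have : lam (T * u) = arcLength γ u := by simp only [lam, hq0]
    refine ⟨T * u, ⟨by rw [mem_preimage, this]; exact hy, mul_nonneg hT.le u.2.1, ?_⟩, this⟩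
    exact mul_le_of_le_one_right hT.le u.2.2
  calc lineIntegral ρ γ = ∫⁻ s in Icc 0 ℓ, ρ (naturalParameterization γ univ 0 s) := rfl
    _ ≤ ∫⁻ s, ρ (naturalParameterization γ univ 0 s)
          ∂(Measure.map lam (volume.restrict (Icc 0 T))) := lintegral_mono' hmeas le_rfl
    _ ≤ ∫⁻ s in Icc 0 T, ρ (naturalParameterization γ univ 0 (lam s)) :=
        -- This inequality needs no measurability of the integrand, so `ρ` may be arbitrary.
        lintegral_map_le _ _
    _ = ∫⁻ s in Icc 0 T, ρ (σ s) := by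
        refine setLIntegral_congr_fun measurableSet_Icc fun s hs => ?_
        simp only [lam]
        rw [naturalParameterization_arcLength hr]
        have : (q s : ℝ) = s / T := by
          simp only [q]
          rw [projIcc_of_mem zero_le_one ⟨div_nonneg hs.1 hT.le, (div_le_one hT).2 hs.2⟩]
        show ρ (σ (T * (q s : ℝ))) = ρ (σ s)
        rw [this, mul_div_cancel₀ _ hT.ne']

/-- A rectifiable path whose distance to `c` passes from at most `p` to at least `q` has length at
least `q - p` inside the annulus `p ≤ dist · c < q`. -/
theorem le_volume_annulus {γ : PlanePath} (h : IsRectifiable γ) {c : Plane} {p q : ℝ}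
    (hp : dist (γ 0) c ≤ p) (hq : q ≤ dist (γ 1) c) :
    ENNReal.ofReal (q - p) ≤ volume (Icc 0 (eVariationOn γ univ).toReal ∩
      {s | p ≤ dist (naturalParameterization γ univ 0 s) c ∧
        dist (naturalParameterization γ univ 0 s) c < q}) := by
  set ν := naturalParameterization γ univ 0 with hν
  set S := Icc 0 (eVariationOn γ univ).toReal ∩ {s | p ≤ dist (ν s) c ∧ dist (ν s) c < q} with hS
  have hL : LipschitzOnWith 1 (fun s => dist (ν s) c) S := by
    have h1 := (lipschitzOnWith_naturalParameterization h).mono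
      (inter_subset_left (t := {s | p ≤ dist (ν s) c ∧ dist (ν s) c < q}))
    have h2 := (LipschitzWith.dist_left c).comp_lipschitzOnWith h1
    rwa [one_mul] at h2
  -- The distance to `c` is `1`-Lipschitz in arc length and maps `S` onto at least `[p, q)`.
  refine le_trans ?_ (volume_image_le_of_lipschitzOnWith hL)
  rw [← Real.volume_Ico]
  refine measure_mono fun y hy => ?_
  have hc : Continuous fun u : unitInterval => dist (γ u) c := by fun_prop
  obtain ⟨u, hu⟩ := intermediate_value_univ (0 : unitInterval) 1 hc
    ⟨hp.trans hy.1, hy.2.le.trans hq⟩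
  have hu' : dist (ν (arcLength γ u)) c = y := by
    rw [hν, naturalParameterization_arcLength h]; exact hu
  refine ⟨arcLength γ u, ⟨⟨?_, ?_⟩, ?_⟩, hu'⟩
  · rw [← arcLength_zero γ]; exact arcLength_monotone h u.2.1
  · rw [← arcLength_one γ]; exact arcLength_monotone h u.2.2
  · rw [mem_ofPred_eq, hu']; exact hy

/-! ### An upper bound for the modulus -/

theorem modulus_mono {F G : Set PlanePath} (h : F ⊆ G) : modulus F ≤ modulus G := by
  refine le_iInf₂ fun ρ hρ => iInf₂_le_of_le ρ ⟨hρ.1, fun γ hγ => hρ.2 γ (h hγ)⟩ le_rfl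

/-- The dyadic annulus with radii `2 ^ k * s` and `2 ^ (k + 1) * s`. -/
def dyadicAnnulus (c : Plane) (s : ℝ) (k : ℕ) : Set Plane :=
  {y | 2 ^ k * s ≤ dist y c ∧ dist y c < 2 ^ (k + 1) * s}

theorem measurableSet_dyadicAnnulus (c : Plane) (s : ℝ) (k : ℕ) :
    MeasurableSet (dyadicAnnulus c s k) := by
  have hd : Measurable fun y : Plane => dist y c := by fun_prop
  exact (measurableSet_le measurable_const hd).inter (measurableSet_lt hd measurable_const)

theorem disjoint_dyadicAnnulus (c : Plane) {s : ℝ} (hs : 0 < s) {k l : ℕ} (hkl : k ≠ l) :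
    Disjoint (dyadicAnnulus c s k) (dyadicAnnulus c s l) := by
  wlog h : k < l generalizing k l
  · exact (this hkl.symm (by omega)).symm
  rw [Set.disjoint_left]
  rintro y ⟨_, h1⟩ ⟨h2, _⟩
  have : (2 : ℝ) ^ (k + 1) ≤ 2 ^ l := pow_le_pow_right₀ (by norm_num) h
  nlinarith

/-- The density used for a chain of `n` dyadic annuli. -/
noncomputable def dyadicDensity (c : Plane) (s : ℝ) (n : ℕ) (y : Plane) : ℝ≥0∞ :=
  ∑ k ∈ Finset.range n,
    (dyadicAnnulus c s k).indicator (fun _ => ENNReal.ofReal (1 / (n * (2 ^ k * s)))) y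

theorem measurable_dyadicDensity (c : Plane) (s : ℝ) (n : ℕ) :
    Measurable (dyadicDensity c s n) := by
  unfold dyadicDensity
  exact Finset.measurable_fun_sum _ fun k _ =>
    measurable_const.indicator (measurableSet_dyadicAnnulus c s k)

/-- The path crosses each of the `n` annuli. The one of width `2 ^ k * s` carries density `1 / (n *
(2 ^ k * s))` and so contributes at least `1 / n`. -/
theorem one_le_lineIntegral_dyadicDensity {γ : PlanePath} (h : IsRectifiable γ) {c : Plane} {s : ℝ}
    (hs : 0 < s) {n : ℕ} (hn : 0 < n) (h0 : dist (γ 0) c ≤ s) (h1 : 2 ^ n * s ≤ dist (γ 1) c) :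
    1 ≤ lineIntegral (dyadicDensity c s n) γ := by
  set ν := naturalParameterization γ univ 0 with hν
  set ℓ := (eVariationOn γ univ).toReal with hℓ
  have hcont : ContinuousOn ν (Icc 0 ℓ) := (lipschitzOnWith_naturalParameterization h).continuousOn
  have hνm : AEMeasurable ν (volume.restrict (Icc 0 ℓ)) := hcont.aemeasurable measurableSet_Icc
  unfold lineIntegral dyadicDensity
  rw [lintegral_finsetSum']
  swap
  · intro k _
    exact (measurable_const.indicator (measurableSet_dyadicAnnulus c s k)).comp_aemeasurable hνm
  have hterm : ∀ k ∈ Finset.range n, ENNReal.ofReal (1 / n) ≤ ∫⁻ t in Icc 0 ℓ,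
      (dyadicAnnulus c s k).indicator (fun _ => ENNReal.ofReal (1 / (n * (2 ^ k * s)))) (ν t) := by
    intro k hk
    have hk' : k + 1 ≤ n := Finset.mem_range.1 hk
    have hv := le_volume_annulus h (c := c) (p := 2 ^ k * s) (q := 2 ^ (k + 1) * s)
      (h0.trans (le_mul_of_one_le_left hs.le (one_le_pow₀ (by norm_num))))
      (le_trans (mul_le_mul_of_nonneg_right (pow_le_pow_right₀ (by norm_num) hk') hs.le) h1)
    have hind : ∀ t, (dyadicAnnulus c s k).indicator
        (fun _ => ENNReal.ofReal (1 / (n * (2 ^ k * s)))) (ν t) =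
        (ν ⁻¹' dyadicAnnulus c s k).indicator
          (fun _ => ENNReal.ofReal (1 / (n * (2 ^ k * s)))) t := fun t => rfl
    simp_rw [hind]
    have hnull : NullMeasurableSet (ν ⁻¹' dyadicAnnulus c s k) (volume.restrict (Icc 0 ℓ)) :=
      hνm.nullMeasurable (measurableSet_dyadicAnnulus c s k)
    rw [lintegral_indicator_const₀ hnull, Measure.restrict_apply₀ hnull, inter_comm]
    refine le_trans ?_ (mul_le_mul_right hv _)
    have hpos : 0 < (2 : ℝ) ^ k * s := by positivity
    rw [← ENNReal.ofReal_mul (by positivity)]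
    refine ENNReal.ofReal_le_ofReal (le_of_eq ?_)
    have hn' : (n : ℝ) ≠ 0 := by positivity
    field_simp
    ring
  refine le_trans ?_ (Finset.sum_le_sum hterm)
  rw [Finset.sum_const, Finset.card_range, nsmul_eq_mul, ← ENNReal.ofReal_natCast,
    ← ENNReal.ofReal_mul (by positivity)]
  have hn' : (n : ℝ) ≠ 0 := by positivity
  rw [mul_one_div_cancel hn', ENNReal.ofReal_one]

/-- Disjointness of the annuli kills the cross terms. Each annulus lies in a disc of area `4π (2 ^ k
* s) ^ 2`, so each of the `n` squares integrates to at most `4π / n ^ 2`. -/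
theorem lintegral_dyadicDensity_sq_le (c : Plane) {s : ℝ} (hs : 0 < s) {n : ℕ} (hn : 0 < n) :
    ∫⁻ y, dyadicDensity c s n y ^ 2 ≤ ENNReal.ofReal (4 * Real.pi / n) := by
  have hsq : ∀ y, dyadicDensity c s n y ^ 2 = ∑ k ∈ Finset.range n,
      (dyadicAnnulus c s k).indicator (fun _ => ENNReal.ofReal (1 / (n * (2 ^ k * s))) ^ 2) y := by
    intro y
    unfold dyadicDensity
    by_cases hy : ∃ k ∈ Finset.range n, y ∈ dyadicAnnulus c s k
    · obtain ⟨k, hk, hyk⟩ := hy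
      have hne : ∀ l ∈ Finset.range n, l ≠ k → y ∉ dyadicAnnulus c s l := fun l _ hl hyl =>
        (disjoint_dyadicAnnulus c hs hl).le_bot ⟨hyl, hyk⟩
      rw [Finset.sum_eq_single_of_mem k hk fun l hl hlk => indicator_of_notMem (hne l hl hlk) _,
        Finset.sum_eq_single_of_mem k hk fun l hl hlk => indicator_of_notMem (hne l hl hlk) _,
        indicator_of_mem hyk, indicator_of_mem hyk]
    · push Not at hy
      rw [Finset.sum_eq_zero fun l hl => indicator_of_notMem (hy l hl) _,
        Finset.sum_eq_zero fun l hl => indicator_of_notMem (hy l hl) _]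
      simp
  simp_rw [hsq]
  rw [lintegral_finsetSum _ fun k _ =>
    measurable_const.indicator (measurableSet_dyadicAnnulus c s k)]
  have hterm : ∀ k ∈ Finset.range n, ∫⁻ y, (dyadicAnnulus c s k).indicator
      (fun _ => ENNReal.ofReal (1 / (n * (2 ^ k * s))) ^ 2) y ≤
      ENNReal.ofReal (4 * Real.pi / n ^ 2) := by
    intro k _
    rw [lintegral_indicator_const (measurableSet_dyadicAnnulus c s k)]
    have hsub : dyadicAnnulus c s k ⊆ Metric.ball c (2 ^ (k + 1) * s) := fun y hy => hy.2
    refine le_trans (mul_le_mul_right (measure_mono hsub) _) ?_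
    rw [EuclideanSpace.volume_ball_fin_two, ← mul_assoc, ← mul_pow,
      ← ENNReal.ofReal_mul (by positivity), ← ENNReal.ofReal_pow (by positivity),
      ← ENNReal.ofReal_mul (by positivity)]
    refine ENNReal.ofReal_le_ofReal (le_of_eq ?_)
    have hn' : (n : ℝ) ≠ 0 := by positivity
    field_simp
    ring
  refine le_trans (Finset.sum_le_sum hterm) ?_
  rw [Finset.sum_const, Finset.card_range, nsmul_eq_mul, ← ENNReal.ofReal_natCast,
    ← ENNReal.ofReal_mul (by positivity)]
  refine ENNReal.ofReal_le_ofReal (le_of_eq ?_)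
  have hn' : (n : ℝ) ≠ 0 := by positivity
  field_simp

/-- The paths crossing a fat annulus have small modulus. -/
theorem modulus_crossing_le (c : Plane) {s : ℝ} (hs : 0 < s) {n : ℕ} (hn : 0 < n) :
    modulus {γ : PlanePath | dist (γ 0) c ≤ s ∧ 2 ^ n * s ≤ dist (γ 1) c} ≤
      ENNReal.ofReal (4 * Real.pi / n) :=
  iInf₂_le_of_le (dyadicDensity c s n)
    ⟨measurable_dyadicDensity c s n, fun _ hγ hr =>
      one_le_lineIntegral_dyadicDensity hr hs hn hγ.1 hγ.2⟩
    (lintegral_dyadicDensity_sq_le c hs hn)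

/-! ### Circles in the plane -/

/-- The unit vector of angle `θ`. -/
noncomputable def dir (θ : ℝ) : Plane := !₂[Real.cos θ, Real.sin θ]

@[simp] theorem dir_zero_apply (θ : ℝ) : dir θ 0 = Real.cos θ := rfl
@[simp] theorem dir_one_apply (θ : ℝ) : dir θ 1 = Real.sin θ := rfl

@[simp] theorem norm_dir (θ : ℝ) : ‖dir θ‖ = 1 := by
  rw [EuclideanSpace.norm_eq, Fin.sum_univ_two]
  simp

theorem dist_dir_sq (θ φ : ℝ) : dist (dir θ) (dir φ) ^ 2 = 2 - 2 * Real.cos (θ - φ) := by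
  rw [EuclideanSpace.dist_eq, Real.sq_sqrt (Finset.sum_nonneg fun _ _ => sq_nonneg _),
    Fin.sum_univ_two, Real.dist_eq, Real.dist_eq, sq_abs, sq_abs, Real.cos_sub]
  simp only [dir_zero_apply, dir_one_apply]
  nlinarith [Real.sin_sq_add_cos_sq θ, Real.sin_sq_add_cos_sq φ]

theorem lipschitzWith_dir : LipschitzWith 1 dir := by
  refine LipschitzWith.of_dist_le_mul fun θ φ => ?_
  rw [NNReal.coe_one, one_mul, Real.dist_eq]
  refine abs_le_of_sq_le_sq' ?_ (abs_nonneg _) |>.2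
  rw [dist_dir_sq, sq_abs]
  nlinarith [Real.one_sub_sq_div_two_le_cos (x := θ - φ)]

theorem exists_angle (p : Plane) : ∃ θ ∈ Icc (-Real.pi) Real.pi, p = ‖p‖ • dir θ := by
  let z : ℂ := ⟨p 0, p 1⟩
  have hz : ‖z‖ = ‖p‖ := by
    rw [EuclideanSpace.norm_eq, Fin.sum_univ_two, Complex.norm_eq_sqrt_sq_add_sq]
    simp [z]
  refine ⟨z.arg, ⟨(Complex.neg_pi_lt_arg z).le, Complex.arg_le_pi z⟩, ?_⟩
  ext i
  fin_cases i
  · simp [← hz, z]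
  · simp [← hz, z]

theorem exists_angle_of_dist_eq {c p : Plane} {t : ℝ} (h : dist p c = t) :
    ∃ θ ∈ Icc (-Real.pi) Real.pi, p = c + t • dir θ := by
  obtain ⟨θ, hθ, h'⟩ := exists_angle (p - c)
  refine ⟨θ, hθ, ?_⟩
  rw [← h, dist_eq_norm, ← h']
  abel

theorem dist_circle (c : Plane) {t : ℝ} (ht : 0 ≤ t) (θ : ℝ) : dist (c + t • dir θ) c = t := by
  rw [dist_eq_norm, add_sub_cancel_left, norm_smul, norm_dir, mul_one, Real.norm_of_nonneg ht]

theorem dist_circle_same (x : Plane) (t m θ : ℝ) :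
    dist (x + t • dir θ) (x + m • dir θ) = |t - m| := by
  rw [dist_add_left, dist_eq_norm, ← sub_smul, norm_smul, norm_dir, mul_one, Real.norm_eq_abs]

theorem dir_add_pi (θ : ℝ) : dir (θ + Real.pi) = -dir θ := by
  ext i; fin_cases i <;> simp [Real.cos_add_pi, Real.sin_add_pi]

/-- As a point runs along the circle of radius `t` about `x`, its distance to `a` takes all values
between `|dist x a - t|` and `dist x a + t`. -/
theorem circles_inter {x a : Plane} {t t' : ℝ} (ht : 0 ≤ t)
    (h1 : |dist x a - t| ≤ t') (h2 : t' ≤ dist x a + t) :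
    ∃ p, dist p x = t ∧ dist p a = t' := by
  obtain ⟨θ, -, ha⟩ := exists_angle_of_dist_eq (dist_comm a x)
  have hm : 0 ≤ dist x a := dist_nonneg
  generalize dist x a = m at *
  subst ha
  have hc : Continuous fun φ : ℝ => dist (x + t • dir φ) (x + m • dir θ) :=
    ((continuous_const.add (lipschitzWith_dir.continuous.const_smul t)).dist continuous_const)
  have e1 : dist (x + t • dir θ) (x + m • dir θ) = |m - t| := by
    rw [dist_circle_same, abs_sub_comm]
  have e2 : dist (x + t • dir (θ + Real.pi)) (x + m • dir θ) = m + t := by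
    rw [dir_add_pi, smul_neg, ← neg_smul, dist_circle_same, ← abs_neg,
      show -(-t - m) = m + t by ring]
    exact abs_of_nonneg (add_nonneg hm ht)
  obtain ⟨φ, hφ⟩ := intermediate_value_univ θ (θ + Real.pi) hc
    (show t' ∈ Icc _ _ from ⟨e1.le.trans h1, h2.trans e2.ge⟩)
  exact ⟨_, dist_circle x ht φ, hφ⟩

/-- The integral of `ρ` along a circle. -/
noncomputable def circleIntegral (ρ : Plane → ℝ≥0∞) (c : Plane) (t : ℝ) : ℝ≥0∞ :=
  ∫⁻ θ in Icc (-Real.pi) Real.pi, ENNReal.ofReal t * ρ (c + t • dir θ)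

theorem exists_arc_lipschitz (ρ : Plane → ℝ≥0∞) {c p q : Plane} {t : ℝ} (ht : 0 < t)
    (hp : dist p c = t) (hq : dist q c = t) :
    ∃ T : ℝ, 0 ≤ T ∧ ∃ σ : ℝ → Plane, LipschitzWith 1 σ ∧ σ 0 = p ∧ σ T = q ∧
      ∫⁻ s in Icc 0 T, ρ (σ s) ≤ circleIntegral ρ c t := by
  obtain ⟨θ₀, h₀, rfl⟩ := exists_angle_of_dist_eq hp
  obtain ⟨θ₁, h₁, rfl⟩ := exists_angle_of_dist_eq hq
  -- `e` is the sense of rotation from `θ₀` to `θ₁`. Both angles lie in `[-π, π]`, so the arc swept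
  -- never wraps around and its integral is part of the full circle integral.
  obtain ⟨e, he, hee⟩ : ∃ e : ℝ, |e| = 1 ∧ e * |θ₁ - θ₀| = θ₁ - θ₀ := by
    rcases le_total 0 (θ₁ - θ₀) with h | h
    · exact ⟨1, by simp, by rw [abs_of_nonneg h, one_mul]⟩
    · exact ⟨-1, by simp, by rw [abs_of_nonpos h]; ring⟩
  have he0 : e ≠ 0 := fun h => by simp [h] at he
  set f : ℝ → ℝ := fun s => θ₀ + e / t * s with hf
  refine ⟨t * |θ₁ - θ₀|, by positivity, fun s => c + t • dir (f s), ?_, ?_, ?_, ?_⟩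
  · refine LipschitzWith.of_dist_le_mul fun s s' => ?_
    have h := lipschitzWith_dir.dist_le_mul (f s) (f s')
    rw [NNReal.coe_one, one_mul] at h ⊢
    rw [dist_add_left, dist_smul₀, Real.norm_of_nonneg ht.le]
    have h2 : dist (f s) (f s') = 1 / t * dist s s' := by
      rw [Real.dist_eq, Real.dist_eq, hf]
      simp only [add_sub_add_left_eq_sub]
      rw [← mul_sub, abs_mul, abs_div, he, abs_of_pos ht]
    calc t * dist (dir (f s)) (dir (f s')) ≤ t * (1 / t * dist s s') := by
          rw [← h2]; exact mul_le_mul_of_nonneg_left h ht.le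
      _ = dist s s' := by field_simp
  · simp [hf]
  · simp only [hf]
    congr 3
    rw [div_mul_eq_mul_div, ← mul_assoc, mul_comm e t, mul_assoc, hee, mul_div_cancel_left₀ _ ht.ne']
    ring
  · have hinj : InjOn f (Icc 0 (t * |θ₁ - θ₀|)) := fun s _ s' _ h => by
      simp only [hf, add_right_inj] at h
      exact mul_left_cancel₀ (div_ne_zero he0 ht.ne') h
    have hder : ∀ s ∈ Icc 0 (t * |θ₁ - θ₀|),
        HasDerivWithinAt f (e / t) (Icc 0 (t * |θ₁ - θ₀|)) s := fun s _ => by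
      have h := (((hasDerivAt_id s).const_mul (e / t)).const_add θ₀).hasDerivWithinAt
        (s := Icc 0 (t * |θ₁ - θ₀|))
      rw [mul_one] at h
      exact h
    have hcv := lintegral_image_eq_lintegral_abs_deriv_mul measurableSet_Icc hder hinj
      (fun θ => ENNReal.ofReal t * ρ (c + t • dir θ))
    have hone : ENNReal.ofReal |e / t| * ENNReal.ofReal t = 1 := by
      rw [← ENNReal.ofReal_mul (abs_nonneg _), abs_div, he, abs_of_pos ht,
        one_div_mul_cancel ht.ne', ENNReal.ofReal_one]
    simp_rw [← mul_assoc, hone, one_mul] at hcv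
    rw [← hcv]
    refine lintegral_mono_set ?_
    rintro _ ⟨s, hs, rfl⟩
    have hs1 : s / t ≤ |θ₁ - θ₀| := (div_le_iff₀' ht).2 hs.2
    have hs0 : 0 ≤ s / t := div_nonneg hs.1 ht.le
    have hfs : f s = θ₀ + e * (s / t) := by simp only [hf]; ring
    rw [hfs]
    rcases le_total 0 (θ₁ - θ₀) with h | h
    · rw [abs_of_nonneg h] at hs1 hee
      rcases (abs_eq zero_le_one).1 he with rfl | rfl
      · constructor <;> linarith [h₀.1, h₁.2]
      · have : θ₁ = θ₀ := by linarith
        subst this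
        constructor <;> linarith [h₀.1, h₁.2]
    · rw [abs_of_nonpos h] at hs1 hee
      rcases (abs_eq zero_le_one).1 he with rfl | rfl
      · have : θ₁ = θ₀ := by linarith
        subst this
        constructor <;> linarith [h₀.1, h₁.2]
      · constructor <;> linarith [h₀.2, h₁.1]

theorem exists_concat_lipschitz (ρ : Plane → ℝ≥0∞) {T₁ T₂ : ℝ} (h₁ : 0 ≤ T₁) (h₂ : 0 ≤ T₂)
    {σ₁ σ₂ : ℝ → Plane} (hσ₁ : LipschitzWith 1 σ₁) (hσ₂ : LipschitzWith 1 σ₂)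
    (h : σ₁ T₁ = σ₂ 0) :
    ∃ σ : ℝ → Plane, LipschitzWith 1 σ ∧ σ 0 = σ₁ 0 ∧ σ (T₁ + T₂) = σ₂ T₂ ∧
      ∫⁻ s in Icc 0 (T₁ + T₂), ρ (σ s) ≤
        (∫⁻ s in Icc 0 T₁, ρ (σ₁ s)) + ∫⁻ s in Icc 0 T₂, ρ (σ₂ s) := by
  -- Clamping the parameter writes the concatenation as one formula; the displacements of the two
  -- clamped parameters add up to at most `dist s s'`, hence `σ` is again `1`-Lipschitz.
  set σ : ℝ → Plane := fun s => σ₁ (min s T₁) + (σ₂ (max (s - T₁) 0) - σ₂ 0) with hσ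
  have e1 : ∀ s, s ≤ T₁ → σ s = σ₁ s := fun s hs => by
    simp [hσ, min_eq_left hs, max_eq_right (sub_nonpos.2 hs)]
  have e2 : ∀ s, T₁ ≤ s → σ s = σ₂ (s - T₁) := fun s hs => by
    simp [hσ, min_eq_right hs, max_eq_left (sub_nonneg.2 hs), h]
  refine ⟨σ, ?_, e1 0 h₁, ?_, ?_⟩
  · refine LipschitzWith.of_dist_le_mul fun s s' => ?_
    rw [NNReal.coe_one, one_mul]
    have a1 := hσ₁.dist_le_mul (min s T₁) (min s' T₁)
    have a2 := hσ₂.dist_le_mul (max (s - T₁) 0) (max (s' - T₁) 0)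
    rw [NNReal.coe_one, one_mul] at a1 a2
    have a3 : dist (min s T₁) (min s' T₁) + dist (max (s - T₁) 0) (max (s' - T₁) 0) ≤
        dist s s' := by
      simp only [Real.dist_eq]
      rcases le_total s T₁ with hs | hs <;> rcases le_total s' T₁ with hs' | hs'
      · simp [min_eq_left hs, min_eq_left hs', max_eq_right (sub_nonpos.2 hs),
          max_eq_right (sub_nonpos.2 hs')]
      · rw [min_eq_left hs, min_eq_right hs', max_eq_right (sub_nonpos.2 hs),
          max_eq_left (sub_nonneg.2 hs'), abs_of_nonpos (by linarith), abs_of_nonpos (by linarith),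
          abs_of_nonpos (by linarith)]
        linarith
      · rw [min_eq_right hs, min_eq_left hs', max_eq_left (sub_nonneg.2 hs),
          max_eq_right (sub_nonpos.2 hs'), abs_of_nonneg (by linarith),
          abs_of_nonneg (by linarith), abs_of_nonneg (by linarith)]
        linarith
      · simp [min_eq_right hs, min_eq_right hs', max_eq_left (sub_nonneg.2 hs),
          max_eq_left (sub_nonneg.2 hs')]
    refine (dist_add_add_le _ _ _ _).trans ?_
    rw [dist_sub_right]
    linarith
  · rw [e2 _ (by linarith), add_sub_cancel_left]
  · have hu : Icc 0 (T₁ + T₂) = Icc 0 T₁ ∪ Icc T₁ (T₁ + T₂) :=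
      (Icc_union_Icc_eq_Icc h₁ (by linarith)).symm
    rw [hu]
    refine (lintegral_union_le _ _ _).trans (add_le_add (le_of_eq ?_) (le_of_eq ?_))
    · exact setLIntegral_congr_fun measurableSet_Icc fun s hs => by rw [e1 s hs.2]
    · rw [setLIntegral_congr_fun measurableSet_Icc fun s hs => by rw [e2 s hs.1]]
      have hmp := measurePreserving_sub_right (volume : Measure ℝ) T₁
      have := hmp.setLIntegral_comp_preimage_emb (MeasurableEquiv.subRight T₁).measurableEmbedding
        (fun s => ρ (σ₂ s)) (Icc 0 T₂)
      rw [preimage_sub_const_Icc, zero_add, add_comm] at this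
      exact this

/-! ### A lower bound for the modulus -/

/-- Since both radii lie between half the distance of the centres and that distance, the circles
meet. Following the first from `E` to a common point and then the second to `F` gives a path of the
family. -/
theorem one_le_circleIntegral_add {E F : Set Plane} {ρ : Plane → ℝ≥0∞}
    (hρ : IsAdmissible {γ | γ 0 ∈ E ∧ γ 1 ∈ F} ρ) {x a : Plane} {t t' : ℝ}
    (ht : t ∈ Ioo (dist x a / 2) (dist x a)) (ht' : t' ∈ Ioo (dist x a / 2) (dist x a))
    (hE : ∃ p ∈ E, dist p x = t) (hF : ∃ q ∈ F, dist q a = t') :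
    1 ≤ circleIntegral ρ x t + circleIntegral ρ a t' := by
  obtain ⟨p, hpE, hp⟩ := hE
  obtain ⟨q, hqF, hq⟩ := hF
  have h0 : 0 ≤ dist x a := dist_nonneg
  have ht0 : 0 < t := lt_of_le_of_lt (by linarith) ht.1
  have ht0' : 0 < t' := lt_of_le_of_lt (by linarith) ht'.1
  obtain ⟨w, hwx, hwa⟩ : ∃ w, dist w x = t ∧ dist w a = t' := by
    refine circles_inter ht0.le ?_ ?_
    · rw [abs_of_nonneg (by linarith [ht.2])]; linarith [ht.1, ht'.1]
    · linarith [ht'.2]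
  obtain ⟨T₁, hT₁, σ₁, hσ₁, h10, h11, hi₁⟩ := exists_arc_lipschitz ρ ht0 hp hwx
  obtain ⟨T₂, hT₂, σ₂, hσ₂, h20, h21, hi₂⟩ := exists_arc_lipschitz ρ ht0' hwa hq
  obtain ⟨σ, hσ, hs0, hs1, hi⟩ := exists_concat_lipschitz ρ hT₁ hT₂ hσ₁ hσ₂ (h11.trans h20.symm)
  have hT : 0 ≤ T₁ + T₂ := add_nonneg hT₁ hT₂
  have hmem : pathOf σ hσ (T₁ + T₂) ∈ {γ : PlanePath | γ 0 ∈ E ∧ γ 1 ∈ F} := by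
    constructor
    · show σ ((T₁ + T₂) * ((0 : unitInterval) : ℝ)) ∈ E
      rw [Set.Icc.coe_zero, mul_zero, hs0, h10]; exact hpE
    · show σ ((T₁ + T₂) * ((1 : unitInterval) : ℝ)) ∈ F
      rw [Set.Icc.coe_one, mul_one, hs1, h21]; exact hqF
  exact (hρ.2 _ hmem (isRectifiable_pathOf hσ hT)).trans
    ((lineIntegral_pathOf_le hσ hT ρ).trans (hi.trans (add_le_add hi₁ hi₂)))

theorem lintegral_polar {g : Plane → ℝ≥0∞} (hg : Measurable g) (c : Plane) :
    ∫⁻ y, g y = ∫⁻ r in Ioi (0 : ℝ), ∫⁻ θ in Ioo (-Real.pi) Real.pi,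
      ENNReal.ofReal r * g (c + r • dir θ) := by
  rw [← lintegral_add_left_eq_self g c]
  let e : ℝ × ℝ ≃ᵐ Plane :=
    MeasurableEquiv.finTwoArrow.symm.trans (MeasurableEquiv.toLp 2 (Fin 2 → ℝ))
  have he : MeasurePreserving e volume volume :=
    (EuclideanSpace.volume_preserving_symm_measurableEquiv_toLp (Fin 2)).symm.comp
      (volume_preserving_finTwoArrow ℝ).symm
  have hpt : ∀ p : ℝ × ℝ, e (polarCoord.symm p) = p.1 • dir p.2 := fun p => by
    ext i
    fin_cases i <;> simp [e, MeasurableEquiv.finTwoArrow, dir]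
  rw [← he.lintegral_comp_emb e.measurableEmbedding (fun y => g (c + y)),
    ← lintegral_comp_polarCoord_symm]
  simp_rw [hpt, smul_eq_mul]
  have hm : Measurable fun p : ℝ × ℝ => ENNReal.ofReal p.1 * g (c + p.1 • dir p.2) := by
    have hd : Continuous fun p : ℝ × ℝ => c + p.1 • dir p.2 :=
      continuous_const.add
        (continuous_fst.smul (lipschitzWith_dir.continuous.comp continuous_snd))
    exact (ENNReal.measurable_ofReal.comp measurable_fst).mul (hg.comp hd.measurable)
  rw [polarCoord_target, Measure.volume_eq_prod, ← Measure.prod_restrict,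
    lintegral_prod _ hm.aemeasurable]

theorem two_mul_mul_le_sq_add_sq (a b : ℝ≥0∞) : 2 * a * b ≤ a ^ 2 + b ^ 2 := by
  rcases eq_or_ne a ⊤ with rfl | ha
  · simp
  rcases eq_or_ne b ⊤ with rfl | hb
  · simp
  lift a to ℝ≥0 using ha
  lift b to ℝ≥0 using hb
  exact_mod_cast two_mul_le_add_sq a b

theorem le_lintegral_sq_of_half_le_circleIntegral {ρ : Plane → ℝ≥0∞} (hρ : Measurable ρ)
    {c : Plane} {t : ℝ} (ht : 0 < t) (h : ENNReal.ofReal (1 / 2) ≤ circleIntegral ρ c t) :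
    ENNReal.ofReal (1 / (8 * Real.pi * t)) ≤
      ∫⁻ θ in Ioo (-Real.pi) Real.pi, ENNReal.ofReal t * ρ (c + t • dir θ) ^ 2 := by
  have hpi := Real.pi_pos
  have hd : Measurable fun θ : ℝ => c + t • dir θ :=
    (continuous_const.add (lipschitzWith_dir.continuous.const_smul t)).measurable
  rw [circleIntegral, setLIntegral_congr Ioo_ae_eq_Icc.symm] at h
  set J := ∫⁻ θ in Ioo (-Real.pi) Real.pi, ENNReal.ofReal t * ρ (c + t • dir θ) ^ 2 with hJ
  -- Cauchy–Schwarz in the form `2 s A ≤ A ^ 2 + s ^ 2`, which avoids square roots in `ℝ≥0∞`.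
  -- Integrated over an interval of length `2π` it leaves `s - 2π s ^ 2`, which is largest, equal to
  -- `1 / (8π)`, at this `s`.
  set s : ℝ := 1 / (4 * Real.pi) with hs
  have hs0 : 0 < s := by positivity
  have hpt : ∀ θ, 2 * ENNReal.ofReal s * (ENNReal.ofReal t * ρ (c + t • dir θ)) ≤
      ENNReal.ofReal t * (ENNReal.ofReal t * ρ (c + t • dir θ) ^ 2) + ENNReal.ofReal s ^ 2 := by
    intro θ
    have := two_mul_mul_le_sq_add_sq (ENNReal.ofReal t * ρ (c + t • dir θ)) (ENNReal.ofReal s)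
    calc _ = 2 * (ENNReal.ofReal t * ρ (c + t • dir θ)) * ENNReal.ofReal s := by ring
      _ ≤ _ := this
      _ = _ := by ring
  have hint := lintegral_mono (μ := volume.restrict (Ioo (-Real.pi) Real.pi)) hpt
  have hm2 : Measurable fun θ : ℝ => ENNReal.ofReal t * ρ (c + t • dir θ) ^ 2 :=
    ((hρ.comp hd).pow_const 2).const_mul _
  have hm1 : Measurable fun θ : ℝ => ENNReal.ofReal t * ρ (c + t • dir θ) :=
    (hρ.comp hd).const_mul _
  rw [lintegral_const_mul _ hm1, lintegral_add_right _ measurable_const,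
    lintegral_const_mul _ hm2, setLIntegral_const, Real.volume_Ioo, sub_neg_eq_add, ← hJ] at hint
  have h1 := (mul_le_mul_right h (2 * ENNReal.ofReal s)).trans hint
  rcases eq_or_ne J ⊤ with hJt | hJt
  · rw [hJt]; exact le_top
  rw [← ENNReal.ofReal_toReal hJt] at h1 ⊢
  rw [← ENNReal.ofReal_ofNat, ← ENNReal.ofReal_mul (by norm_num), ← ENNReal.ofReal_mul (by positivity),
    ← ENNReal.ofReal_mul ht.le, ← ENNReal.ofReal_pow hs0.le, ← ENNReal.ofReal_mul (by positivity),
    ← ENNReal.ofReal_add (by positivity) (by positivity),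
    ENNReal.ofReal_le_ofReal_iff (by positivity)] at h1
  refine ENNReal.ofReal_le_ofReal ?_
  rw [div_le_iff₀ (by positivity)]
  have h2 : s * (4 * Real.pi) = 1 := by rw [hs]; field_simp
  nlinarith

/-- Two circle integrals, one about each centre, add up to at least `1`. So either every circle
about `x` carries at least `1 / 2`, or one of them fails and then every circle about `a` does.
Integrating `1 / (8π t)` over radii between half the distance and the distance gives the constant.
-/
theorem le_modulus_joining {E F : Set Plane} {x a : Plane} (hxa : x ≠ a)
    (hE : ∀ t ∈ Ioo (dist x a / 2) (dist x a), ∃ p ∈ E, dist p x = t)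
    (hF : ∀ t ∈ Ioo (dist x a / 2) (dist x a), ∃ q ∈ F, dist q a = t) :
    ENNReal.ofReal (1 / (16 * Real.pi)) ≤ modulus {γ | γ 0 ∈ E ∧ γ 1 ∈ F} := by
  refine le_iInf₂ fun ρ hρ => ?_
  have hm : 0 < dist x a := dist_pos.2 hxa
  have key : ∀ c : Plane, (∀ t ∈ Ioo (dist x a / 2) (dist x a),
      ENNReal.ofReal (1 / 2) ≤ circleIntegral ρ c t) →
      ENNReal.ofReal (1 / (16 * Real.pi)) ≤ ∫⁻ y, ρ y ^ 2 := by
    intro c hc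
    rw [lintegral_polar (hρ.1.pow_const 2) c]
    have hsub : Ioo (dist x a / 2) (dist x a) ⊆ Ioi 0 := fun t ht =>
      lt_of_le_of_lt (by positivity) ht.1
    refine le_trans ?_ (lintegral_mono_set hsub)
    have hle : ∫⁻ _ in Ioo (dist x a / 2) (dist x a),
        ENNReal.ofReal (1 / (8 * Real.pi * dist x a)) ≤
        ∫⁻ r in Ioo (dist x a / 2) (dist x a), ∫⁻ θ in Ioo (-Real.pi) Real.pi,
          ENNReal.ofReal r * ρ (c + r • dir θ) ^ 2 := by
      refine setLIntegral_mono' measurableSet_Ioo fun t ht => ?_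
      refine le_trans (ENNReal.ofReal_le_ofReal ?_)
        (le_lintegral_sq_of_half_le_circleIntegral hρ.1 (hsub ht) (hc t ht))
      have : 0 < t := hsub ht
      exact one_div_le_one_div_of_le (by positivity)
        (mul_le_mul_of_nonneg_left ht.2.le (by positivity))
    refine le_trans (le_of_eq ?_) hle
    rw [setLIntegral_const, Real.volume_Ioo, ← ENNReal.ofReal_mul (by positivity)]
    congr 1
    field_simp
    ring
  by_cases hall : ∀ t ∈ Ioo (dist x a / 2) (dist x a),
      ENNReal.ofReal (1 / 2) ≤ circleIntegral ρ x t
  · exact key x hall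
  · push Not at hall
    obtain ⟨t, ht, htlt⟩ := hall
    refine key a fun t' ht' => ?_
    by_contra hlt
    push Not at hlt
    have h1 := one_le_circleIntegral_add hρ ht ht' (hE t ht) (hF t' ht')
    have h2 := ENNReal.add_lt_add htlt hlt
    rw [← ENNReal.ofReal_add (by norm_num) (by norm_num)] at h2
    norm_num at h2
    exact absurd h1 (not_le.2 h2)

/-! ### Plane quasiconformal maps are weakly quasisymmetric -/

/-- The ray leaves the compact set `f '' closedBall a t`, so its preimage leaves the disc about `a`,
and an intermediate value argument applies. -/
theorem exists_ray_hits (f : Plane ≃ₜ Plane) {a v : Plane} (hv : v ≠ 0) {t : ℝ} (ht : 0 ≤ t) :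
    ∃ l : ℝ, 0 ≤ l ∧ dist (f.symm (f a + l • v)) a = t := by
  have hc : Continuous fun l : ℝ => dist (f.symm (f a + l • v)) a := by
    have := f.symm.continuous
    fun_prop
  obtain ⟨L, hL0, hL⟩ : ∃ L : ℝ, 0 ≤ L ∧ t ≤ dist (f.symm (f a + L • v)) a := by
    by_contra! hcon
    have hcpt : IsCompact (f '' Metric.closedBall a t) :=
      (isCompact_closedBall a t).image f.continuous
    obtain ⟨R, hR⟩ := hcpt.isBounded.subset_closedBall (f a)
    have hR' : ∀ l : ℝ, 0 ≤ l → l * ‖v‖ ≤ R := fun l hl => by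
      have : f a + l • v ∈ Metric.closedBall (f a) R :=
        hR ⟨f.symm (f a + l • v), (hcon l hl).le, f.apply_symm_apply _⟩
      rw [Metric.mem_closedBall, dist_eq_norm, add_sub_cancel_left, norm_smul,
        Real.norm_of_nonneg hl] at this
      exact this
    have hvpos : 0 < ‖v‖ := norm_pos_iff.2 hv
    have hR0 : 0 ≤ R := by simpa using hR' 0 le_rfl
    have := hR' ((R + 1) / ‖v‖) (by positivity)
    rw [div_mul_cancel₀ _ hvpos.ne'] at this
    linarith
  obtain ⟨l, hl, hl'⟩ := intermediate_value_Icc hL0 hc.continuousOn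
    (show t ∈ Icc _ _ from ⟨by simpa using ht, hL⟩)
  exact ⟨l, hl.1, hl'⟩

/-- If `f a` were much farther from `f x` than `f b`, the images of paths from `E` to `F` would
cross a fat annulus and have modulus at most `4π / n`. Yet `E` is connected and contains `x` and
`b`, while `F` contains the preimage of a ray from `f a` to infinity, so the original family has
modulus at least `1 / (16π)`. Quasi-invariance forces `n ≤ 64π² K`, against the choice of `n`. -/
theorem IsQuasiconformal.weak_quasisymmetric {K : ℝ} {f : Plane ≃ₜ Plane}
    (hf : IsQuasiconformal K f) : ∃ H : ℝ, 1 ≤ H ∧ ∀ x a b : Plane, dist x a ≤ dist x b →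
      dist (f x) (f a) ≤ H * dist (f x) (f b) := by
  obtain ⟨hK, hmod⟩ := hf
  obtain ⟨n, hn⟩ := exists_nat_gt (64 * Real.pi ^ 2 * K)
  have hn0 : 0 < n := by
    have : (0 : ℝ) < n := lt_of_le_of_lt (by positivity) hn
    exact_mod_cast this
  refine ⟨2 ^ n, one_le_pow₀ (by norm_num), fun x a b hab => ?_⟩
  by_contra! hlt
  set s := dist (f x) (f b) with hs
  have hxa : x ≠ a := by
    rintro rfl
    rw [dist_self] at hlt
    have : 0 ≤ 2 ^ n * s := by positivity
    linarith
  have hm : 0 < dist x a := dist_pos.2 hxa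
  have hs0 : 0 < s := dist_pos.2 (f.injective.ne (dist_pos.1 (hm.trans_le hab)))
  set E : Set Plane := {y | dist (f y) (f x) ≤ s}
  set F : Set Plane := {y | 2 ^ n * s ≤ dist (f y) (f x)}
  have hlow : ENNReal.ofReal (1 / (16 * Real.pi)) ≤
      modulus {γ : PlanePath | γ 0 ∈ E ∧ γ 1 ∈ F} := by
    refine le_modulus_joining hxa (fun t ht => ?_) (fun t ht => ?_)
    · have hconn : IsPreconnected E := by
        have : E = f.symm '' Metric.closedBall (f x) s := by
          rw [f.symm.image_eq_preimage_symm]; rfl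
        rw [this]
        exact (convex_closedBall _ _).isPreconnected.image _ f.symm.continuous.continuousOn
      have hxE : x ∈ E := by simp [E, hs0.le]
      have hbE : b ∈ E := by simp [E, hs, dist_comm]
      have hc : ContinuousOn (fun y => dist y x) E := by fun_prop
      have h0 : 0 < t := lt_of_le_of_lt (by positivity) ht.1
      obtain ⟨p, hp, hp'⟩ := hconn.intermediate_value hxE hbE hc
        (show t ∈ Icc _ _ from ⟨by simpa using h0.le, by
          rw [dist_comm]; exact ht.2.le.trans hab⟩)
      exact ⟨p, hp, hp'⟩
    · have h0 : 0 < t := lt_of_le_of_lt (by positivity) ht.1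
      have hv : f a - f x ≠ 0 := sub_ne_zero.2 (f.injective.ne hxa.symm)
      obtain ⟨l, hl, hl'⟩ := exists_ray_hits f (a := a) hv h0.le
      refine ⟨_, ?_, hl'⟩
      show 2 ^ n * s ≤ dist (f (f.symm (f a + l • (f a - f x)))) (f x)
      rw [f.apply_symm_apply, dist_eq_norm,
        show f a + l • (f a - f x) - f x = (1 + l) • (f a - f x) by module, norm_smul,
        Real.norm_of_nonneg (by linarith), ← dist_eq_norm, dist_comm]
      have : 0 ≤ dist (f x) (f a) := dist_nonneg
      nlinarith
  have himg : mapFamily f {γ : PlanePath | γ 0 ∈ E ∧ γ 1 ∈ F} ⊆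
      {γ : PlanePath | dist (γ 0) (f x) ≤ s ∧ 2 ^ n * s ≤ dist (γ 1) (f x)} := by
    rintro _ ⟨γ, hγ, rfl⟩
    exact hγ
  have hup := (modulus_mono himg).trans (modulus_crossing_le (f x) hs0 hn0)
  have hfin := hlow.trans ((hmod _).1.trans (mul_le_mul_right hup _))
  rw [← ENNReal.ofReal_mul (by linarith), ENNReal.ofReal_le_ofReal_iff (by positivity)] at hfin
  have hn' : (0 : ℝ) < n := by exact_mod_cast hn0
  have hpi := Real.pi_pos
  rw [mul_div_assoc', div_le_div_iff₀ (by positivity) hn'] at hfin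
  nlinarith

/-! ### Cutting an arc into pieces of comparable diameter -/

theorem isBounded_image_Icc {G : ℝ → Plane} (hG : Continuous G) (a b : ℝ) :
    Bornology.IsBounded (G '' Icc a b) := (isCompact_Icc.image hG).isBounded

theorem diam_image_Icc_mono {G : ℝ → Plane} (hG : Continuous G) {a b a' b' : ℝ} (ha : a' ≤ a)
    (hb : b ≤ b') : Metric.diam (G '' Icc a b) ≤ Metric.diam (G '' Icc a' b') :=
  Metric.diam_mono (image_mono (Icc_subset_Icc ha hb)) (isBounded_image_Icc hG _ _)

theorem diam_image_Icc_le_add {G : ℝ → Plane} (hG : Continuous G) (a : ℝ) {b c : ℝ} (hbc : b ≤ c) :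
    Metric.diam (G '' Icc a c) ≤ Metric.diam (G '' Icc a b) + Metric.diam (G '' Icc b c) := by
  rcases le_total a b with hab | hab
  · rw [← Icc_union_Icc_eq_Icc hab hbc, image_union]
    exact Metric.diam_union' ⟨G b, mem_image_of_mem _ ⟨hab, le_rfl⟩, mem_image_of_mem _ ⟨le_rfl, hbc⟩⟩
  · have := diam_image_Icc_mono hG (b := c) hab le_rfl
    linarith [Metric.diam_nonneg (s := G '' Icc a b)]

theorem continuous_diam_image_Icc_right {G : ℝ → Plane} (hG : UniformContinuous G) (a : ℝ) :
    Continuous fun b => Metric.diam (G '' Icc a b) := by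
  refine Metric.continuous_iff.2 fun b ε hε => ?_
  obtain ⟨δ, hδ, h⟩ := Metric.uniformContinuous_iff.1 hG (ε / 2) (half_pos hε)
  have key : ∀ b₁ b₂ : ℝ, b₁ ≤ b₂ → b₂ - b₁ < δ →
      |Metric.diam (G '' Icc a b₂) - Metric.diam (G '' Icc a b₁)| < ε := by
    intro b₁ b₂ h12 hlt
    have h1 := diam_image_Icc_le_add hG.continuous a h12
    have h2 := diam_image_Icc_mono hG.continuous (le_refl a) h12
    have h3 : Metric.diam (G '' Icc b₁ b₂) ≤ ε / 2 := by
      refine Metric.diam_le_of_forall_dist_le (half_pos hε).le ?_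
      rintro _ ⟨u, hu, rfl⟩ _ ⟨v, hv, rfl⟩
      refine (h ?_).le
      rw [Real.dist_eq, abs_lt]
      constructor <;> linarith [hu.1, hu.2, hv.1, hv.2]
    rw [abs_of_nonneg (by linarith)]
    linarith
  refine ⟨δ, hδ, fun c hc => ?_⟩
  rw [Real.dist_eq] at hc ⊢
  rcases le_total b c with hbc | hbc
  · exact key b c hbc ((le_abs_self _).trans_lt hc)
  · rw [abs_sub_comm] at hc ⊢
    exact key c b hbc ((le_abs_self _).trans_lt hc)

theorem continuous_diam_image_Icc_left {G : ℝ → Plane} (hG : UniformContinuous G) (b : ℝ) :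
    Continuous fun a => Metric.diam (G '' Icc a b) := by
  have h := (continuous_diam_image_Icc_right (hG.comp uniformContinuous_neg) (-b)).comp
    continuous_neg
  refine h.congr fun a => ?_
  have hneg : (fun x : ℝ => -x) '' Icc (-b) (-a) = Icc a b := by simp
  change Metric.diam ((G ∘ fun x => -x) '' Icc (-b) (-a)) = _
  rw [image_comp, hneg]

/-- Cut greedily pieces of diameter exactly `e`. By uniform continuity every piece of diameter at
least `e / 2` uses a parameter length at least `δ`, so the process stops. -/
theorem exists_cuts {G : ℝ → Plane} (hG : UniformContinuous G) {e : ℝ} (he : 0 < e) {a : ℝ}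
    (hda : e / 2 ≤ Metric.diam (G '' Icc a 1)) :
    ∃ N : ℕ, 1 ≤ N ∧ ∃ t : ℕ → ℝ, t 0 = a ∧ t N = 1 ∧ (∀ i < N, t i < t (i + 1)) ∧
      ∀ i < N, e / 2 ≤ Metric.diam (G '' Icc (t i) (t (i + 1))) ∧
        Metric.diam (G '' Icc (t i) (t (i + 1))) ≤ e := by
  obtain ⟨δ, hδ, h⟩ := Metric.uniformContinuous_iff.1 hG (e / 4) (by positivity)
  have hshort : ∀ u v : ℝ, e / 2 ≤ Metric.diam (G '' Icc u v) → δ ≤ v - u := by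
    intro u v huv
    by_contra! hlt
    have h3 : Metric.diam (G '' Icc u v) ≤ e / 4 := by
      refine Metric.diam_le_of_forall_dist_le (by positivity) ?_
      rintro _ ⟨x, hx, rfl⟩ _ ⟨y, hy, rfl⟩
      refine (h ?_).le
      rw [Real.dist_eq, abs_lt]
      constructor <;> linarith [hx.1, hx.2, hy.1, hy.2]
    linarith
  have main : ∀ n : ℕ, ∀ a : ℝ, 1 - a ≤ n * δ → e / 2 ≤ Metric.diam (G '' Icc a 1) →
      ∃ N : ℕ, 1 ≤ N ∧ ∃ t : ℕ → ℝ, t 0 = a ∧ t N = 1 ∧ (∀ i < N, t i < t (i + 1)) ∧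
      ∀ i < N, e / 2 ≤ Metric.diam (G '' Icc (t i) (t (i + 1))) ∧
        Metric.diam (G '' Icc (t i) (t (i + 1))) ≤ e := by
    intro n
    induction n with
    | zero =>
      intro a h1 h2
      have := hshort _ _ h2
      simp only [Nat.cast_zero, zero_mul] at h1
      linarith
    | succ n ih =>
      intro a h1 h2
      have hlen := hshort _ _ h2
      have ha1 : a ≤ 1 := by linarith
      have hself : Metric.diam (G '' Icc a a) = 0 := by simp
      rcases le_or_gt (Metric.diam (G '' Icc a 1)) e with hle | hgt
      · refine ⟨1, le_rfl, fun i => if i = 0 then a else 1, by simp, by simp, ?_, ?_⟩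
        · intro i hi
          obtain rfl : i = 0 := by omega
          simp only [if_true, zero_add, one_ne_zero, if_false]
          linarith
        · intro i hi
          obtain rfl : i = 0 := by omega
          simpa using ⟨h2, hle⟩
      · obtain ⟨b, ⟨hab, hb1⟩, hb⟩ := intermediate_value_Icc ha1
          (continuous_diam_image_Icc_right hG a).continuousOn
          (show e ∈ Icc _ _ from ⟨by simpa using he.le, hgt.le⟩)
        simp only at hb
        have hblen := hshort a b (by linarith)
        rcases le_or_gt (e / 2) (Metric.diam (G '' Icc b 1)) with hbig | hsmall
        · obtain ⟨N, hN, t, t0, tN, tm, td⟩ := ih b (by push_cast at h1; linarith) hbig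
          refine ⟨N + 1, by omega, fun i => if i = 0 then a else t (i - 1), by simp, by simpa using tN,
            ?_, ?_⟩
          · intro i hi
            rcases i with _ | i
            · simp only [if_true, zero_add, one_ne_zero, if_false, Nat.sub_self, t0]; linarith
            · simpa using tm i (by omega)
          · intro i hi
            rcases i with _ | i
            · simp only [if_true, zero_add, one_ne_zero, if_false, Nat.sub_self, t0, hb]
              constructor <;> linarith
            · simpa using td i (by omega)
        -- The remainder after `b` is too small, so the cut is moved back to `c`, where the tail has
        -- diameter exactly `e / 2`. The head then keeps more than `e / 2`, because the total
        -- exceeds `e`, and at most `e`, because `c ≤ b`.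
        · obtain ⟨c, ⟨hac, hcb⟩, hc⟩ := intermediate_value_Icc' hab
            (continuous_diam_image_Icc_left hG 1).continuousOn
            (show e / 2 ∈ Icc _ _ from ⟨hsmall.le, by linarith⟩)
          simp only at hc
          have hc1 := hshort c 1 hc.ge
          have h3 := diam_image_Icc_le_add hG.continuous a (hcb.trans hb1)
          have h4 := diam_image_Icc_mono hG.continuous (le_refl a) hcb
          have hclen := hshort a c (by linarith)
          refine ⟨2, by omega, fun i => if i = 0 then a else if i = 1 then c else 1, by simp,
            by simp, ?_, ?_⟩
          · intro i hi
            interval_cases i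
            · simp only [if_true, zero_add, one_ne_zero, if_false]; linarith
            · simp; linarith
          · intro i hi
            interval_cases i
            · simp only [if_true, zero_add, one_ne_zero, if_false]
              constructor <;> linarith
            · simp only [one_ne_zero, if_false, if_true, show (1 + 1 = 0) = False by simp,
                show (1 + 1 = 1) = False by simp]
              constructor <;> linarith
  obtain ⟨n, hn⟩ := exists_nat_ge ((1 - a) / δ)
  exact main n a ((div_le_iff₀ hδ).1 hn) hda

/-! ### Two points of the circle and the arcs between them -/

theorem norm_exp_sub_exp_sq (u v : ℝ) :
    ‖Complex.exp (u * Complex.I) - Complex.exp (v * Complex.I)‖ ^ 2 =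
      2 - 2 * Real.cos (u - v) := by
  rw [← Complex.normSq_eq_norm_sq, Complex.normSq_apply]
  simp only [Complex.sub_re, Complex.sub_im, Complex.exp_ofReal_mul_I_re,
    Complex.exp_ofReal_mul_I_im]
  rw [Real.cos_sub]
  nlinarith [Real.sin_sq_add_cos_sq u, Real.sin_sq_add_cos_sq v]

/-- Suppose `Φ p` and `Φ q`, with `q < s < p < t`, are both farther from `Φ s` than `Φ t` is.
Cutting the circle at `Φ t` gives an angle that is continuous and injective on `[q, p]`, hence
strictly monotone, so `q` and `p` lie on opposite sides of `s`. But the cap about `Φ s` reaching to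
`Φ t` covers one whole side. -/
theorem circle_arc_subset_ball {Φ : ℝ → ℂ} (hc : ContinuousOn Φ (Icc 0 1))
    (hinj : InjOn Φ (Icc 0 1)) (hn : ∀ t ∈ Icc (0 : ℝ) 1, ‖Φ t‖ = 1) {s t : ℝ} (hs : 0 ≤ s)
    (hst : s < t) (ht : t ≤ 1) :
    (∀ u ∈ Icc s t, ‖Φ u - Φ s‖ ≤ ‖Φ t - Φ s‖) ∨
      (∀ u ∈ Icc 0 s, ‖Φ u - Φ s‖ ≤ ‖Φ t - Φ s‖) := by
  by_contra! hcon
  obtain ⟨⟨p, hp, hp'⟩, ⟨q, hq, hq'⟩⟩ := hcon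
  have hpt : p < t := lt_of_le_of_ne hp.2 fun h => by simp [h] at hp'
  have hsp : s < p := lt_of_le_of_ne hp.1 fun h => by
    simp only [← h, sub_self, norm_zero] at hp'
    exact absurd hp' (not_lt.2 (norm_nonneg _))
  have hqs : q < s := lt_of_le_of_ne hq.2 fun h => by
    simp only [h, sub_self, norm_zero] at hq'
    exact absurd hq' (not_lt.2 (norm_nonneg _))
  have hsub : Icc q p ⊆ Icc 0 1 := Icc_subset_Icc hq.1 (hpt.le.trans ht)
  have ht01 : t ∈ Icc (0 : ℝ) 1 := ⟨hs.trans hst.le, ht⟩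
  have hΦt : ‖Φ t‖ = 1 := hn t ht01
  have hΦt0 : Φ t ≠ 0 := norm_ne_zero_iff.1 (by rw [hΦt]; norm_num)
  -- The minus sign puts the branch cut of `arg` at `Φ t`, a value not taken on `[q, p]`.
  set W : ℝ → ℝ := fun u => Complex.arg (-Φ u / Φ t) with hW
  have hexp : ∀ u ∈ Icc q p, Complex.exp (W u * Complex.I) = -Φ u / Φ t := fun u hu => by
    have h1 : ‖-Φ u / Φ t‖ = 1 := by rw [norm_div, norm_neg, hn u (hsub hu), hΦt, div_one]
    have := Complex.norm_mul_exp_arg_mul_I (-Φ u / Φ t)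
    rwa [h1, Complex.ofReal_one, one_mul] at this
  have hΦ : ∀ u ∈ Icc q p, Φ u = -Φ t * Complex.exp (W u * Complex.I) := fun u hu => by
    rw [hexp u hu]; field_simp
  have hWlt : ∀ u ∈ Icc q p, W u < Real.pi := fun u hu => by
    refine lt_of_le_of_ne (Complex.arg_le_pi _) fun h => ?_
    have h1 := hΦ u hu
    rw [h, Complex.exp_pi_mul_I, mul_neg, mul_one, neg_neg] at h1
    exact absurd (hinj (hsub hu) ht01 h1) (ne_of_lt (hu.2.trans_lt hpt))
  have hWgt : ∀ u, -Real.pi < W u := fun u => Complex.neg_pi_lt_arg _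
  have hWc : ContinuousOn W (Icc q p) := by
    have h1 : ContinuousOn (fun u => -Φ u / Φ t) (Icc q p) :=
      ((hc.mono hsub).neg).div_const _
    refine ContinuousOn.comp (t := Complex.slitPlane)
      (fun z hz => (Complex.continuousAt_arg hz).continuousWithinAt) h1 fun u hu => ?_
    rw [Complex.mem_slitPlane_iff_arg]
    refine ⟨(hWlt u hu).ne, ?_⟩
    rw [← hexp u hu]
    exact Complex.exp_ne_zero _
  have hWinj : InjOn W (Icc q p) := fun u hu v hv h => by
    refine hinj (hsub hu) (hsub hv) ?_
    rw [hΦ u hu, hΦ v hv, h]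
  have hs' : s ∈ Icc q p := ⟨hqs.le, hsp.le⟩
  have hdist : ∀ u ∈ Icc q p, ‖Φ u - Φ s‖ ^ 2 = 2 - 2 * Real.cos (W u - W s) := fun u hu => by
    rw [hΦ u hu, hΦ s hs', ← mul_sub, norm_mul, norm_neg, hΦt, one_mul, norm_exp_sub_exp_sq]
  have hdistt : ‖Φ t - Φ s‖ ^ 2 = 2 - 2 * Real.cos (Real.pi - W s) := by
    rw [hΦ s hs', ← norm_exp_sub_exp_sq, Complex.exp_pi_mul_I,
      show Φ t - -Φ t * Complex.exp (W s * Complex.I) =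
        -Φ t * (-1 - Complex.exp (W s * Complex.I)) by ring, norm_mul, norm_neg, hΦt, one_mul]
  have hfar : ∀ u ∈ Icc q p, ‖Φ t - Φ s‖ < ‖Φ u - Φ s‖ →
      Real.cos (W u - W s) < Real.cos (Real.pi - W s) := fun u hu h => by
    have h1 := pow_lt_pow_left₀ h (norm_nonneg _) two_ne_zero
    rw [hdist u hu, hdistt] at h1
    linarith
  have hq1 : q ∈ Icc q p := ⟨le_rfl, (hqs.trans hsp).le⟩
  have hp1 : p ∈ Icc q p := ⟨(hqs.trans hsp).le, le_rfl⟩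
  have hcq := hfar q hq1 hq'
  have hcp := hfar p hp1 hp'
  have hside : (W q ≤ W s ∧ W p ≤ W s) ∨ (W s ≤ W q ∧ W s ≤ W p) := by
    rcases le_total 0 (W s) with h0 | h0
    · have h1 : ∀ u ∈ Icc q p, Real.cos (W u - W s) < Real.cos (Real.pi - W s) → W u ≤ W s := by
        intro u hu h
        by_contra! hlt
        refine absurd h (not_lt.2 (Real.cos_le_cos_of_nonneg_of_le_pi ?_ ?_ ?_))
        · linarith
        · linarith
        · linarith [hWlt u hu]
      exact Or.inl ⟨h1 q hq1 hcq, h1 p hp1 hcp⟩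
    · have h1 : ∀ u ∈ Icc q p, Real.cos (W u - W s) < Real.cos (Real.pi - W s) → W s ≤ W u := by
        intro u hu h
        by_contra! hlt
        rw [← Real.cos_neg (W u - W s), neg_sub, Real.cos_pi_sub, ← Real.cos_add_pi] at h
        refine absurd h (not_lt.2 (Real.cos_le_cos_of_nonneg_of_le_pi ?_ ?_ ?_))
        · linarith
        · linarith
        · linarith [hWgt u]
      exact Or.inr ⟨h1 q hq1 hcq, h1 p hp1 hcp⟩
  rcases hWc.strictMonoOn_of_injOn_Icc' (hqs.trans hsp).le hWinj with hm | hm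
  · have h1 := hm hq1 hs' hqs
    have h2 := hm hs' hp1 hsp
    rcases hside with h | h <;> linarith [h.1, h.2]
  · have h1 := hm hq1 hs' hqs
    have h2 := hm hs' hp1 hsp
    rcases hside with h | h <;> linarith [h.1, h.2]

theorem sphere_arc_subset_ball {Φ : ℝ → Plane} (hc : ContinuousOn Φ (Icc 0 1))
    (hinj : InjOn Φ (Icc 0 1)) (hn : ∀ t ∈ Icc (0 : ℝ) 1, ‖Φ t‖ = 1) {s t : ℝ} (hs : 0 ≤ s)
    (hst : s < t) (ht : t ≤ 1) :
    (∀ u ∈ Icc s t, dist (Φ s) (Φ u) ≤ dist (Φ s) (Φ t)) ∨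
      (∀ u ∈ Icc 0 s, dist (Φ s) (Φ u) ≤ dist (Φ s) (Φ t)) := by
  let e := Complex.orthonormalBasisOneI.repr.symm
  have h := circle_arc_subset_ball (Φ := fun u => e (Φ u)) (e.continuous.comp_continuousOn hc)
    (fun u hu v hv h => hinj hu hv (e.injective h))
    (fun u hu => by rw [e.norm_map]; exact hn u hu) hs hst ht
  simpa only [← dist_eq_norm, e.dist_map, dist_comm (Φ s)] using h

/-- Cut points of an arc on a quasicircle are separated when the pieces are large. -/
theorem le_dist_of_cuts {f : Plane ≃ₜ Plane} {H : ℝ} (hH : 1 ≤ H)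
    (hf : ∀ x a b : Plane, dist x a ≤ dist x b → dist (f x) (f a) ≤ H * dist (f x) (f b))
    {G : ℝ → Plane} (hG : Continuous G) (hinj : InjOn G (Icc 0 1))
    (hmem : ∀ u ∈ Icc (0 : ℝ) 1, G u ∈ f '' Metric.sphere (0 : Plane) 1) {d : ℝ}
    {r s r' t : ℝ} (hr : 0 ≤ r) (hrs : r ≤ s) (hsr' : s < r') (hr't : r' ≤ t) (ht : t ≤ 1)
    (h1 : d ≤ Metric.diam (G '' Icc 0 r)) (h2 : d ≤ Metric.diam (G '' Icc s r')) :
    d ≤ 2 * H * dist (G s) (G t) := by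
  have hnorm : ∀ u ∈ Icc (0 : ℝ) 1, ‖f.symm (G u)‖ = 1 := fun u hu => by
    obtain ⟨y, hy, hyu⟩ := hmem u hu
    rw [← hyu, f.symm_apply_apply]
    simpa using hy
  have hbd : ∀ A : Set ℝ, (∀ u ∈ A, dist (f.symm (G s)) (f.symm (G u)) ≤
      dist (f.symm (G s)) (f.symm (G t))) → Metric.diam (G '' A) ≤ 2 * H * dist (G s) (G t) := by
    intro A hA
    have hsub : G '' A ⊆ Metric.closedBall (G s) (H * dist (G s) (G t)) := by
      rintro _ ⟨u, hu, rfl⟩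
      have := hf _ _ _ (hA u hu)
      simp only [f.apply_symm_apply] at this
      rwa [Metric.mem_closedBall, dist_comm]
    refine (Metric.diam_mono hsub Metric.isBounded_closedBall).trans ?_
    rw [mul_assoc]
    exact Metric.diam_closedBall (by positivity)
  -- One of the two arcs starting at `s`, forwards to `t` or backwards to `0`, is trapped near `G
  -- s`. Each contains an arc of diameter at least `d`, namely `[s, r']` or `[0, r]`.
  rcases sphere_arc_subset_ball (Φ := fun u => f.symm (G u))
    (f.symm.continuous.comp hG).continuousOn
    (fun u hu v hv h => hinj hu hv (f.symm.injective h)) hnorm (hr.trans hrs)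
    (hsr'.trans_le hr't) ht with h | h
  · exact h2.trans (hbd _ fun u hu => h u ⟨hu.1, hu.2.trans hr't⟩)
  · exact h1.trans (hbd _ fun u hu => h u ⟨hu.1, hu.2.trans hrs⟩)

/-! ### Packing of caps on the sphere -/

/-- The part between the radii `1 / 2` and `1` of the cone over a spherical cap. -/
def capCone (q : Space) (s : ℝ) : Set Space :=
  {w | (1 / 2 < ‖w‖ ∧ ‖w‖ < 1) ∧ dist (‖w‖⁻¹ • w) q < s}

theorem measurableSet_capCone (q : Space) (s : ℝ) : MeasurableSet (capCone q s) := by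
  have h1 : Measurable fun w : Space => ‖w‖ := measurable_norm
  have h2 : Measurable fun w : Space => dist (‖w‖⁻¹ • w) q :=
    (h1.inv.smul measurable_id).dist measurable_const
  exact ((measurableSet_lt measurable_const h1).inter (measurableSet_lt h1 measurable_const)).inter
    (measurableSet_lt h2 measurable_const)

theorem dist_normalize {w q : Space} (hw : 0 < ‖w‖) :
    dist w (‖w‖ • q) = ‖w‖ * dist (‖w‖⁻¹ • w) q := by
  conv_lhs => rw [← smul_inv_smul₀ hw.ne' w]
  rw [smul_inv_smul₀ hw.ne']
  nth_rewrite 1 [← smul_inv_smul₀ hw.ne' w]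
  rw [dist_smul₀, norm_norm]

/-- For `S < 1` the truncated cone is covered by `n` balls of radius `2 * S` centred on its axis,
with `n * S ≤ 2`; for larger `S` the unit ball suffices. -/
theorem volume_capCone_le (q : Space) (hq : ‖q‖ = 1) {S : ℝ} (hS : 0 < S) :
    volume (capCone q S) ≤ ENNReal.ofReal (16 * (Real.pi * 4 / 3) * S ^ 2) := by
  have hpi := Real.pi_pos
  rcases le_or_gt 1 S with h1 | h1
  · have hsub : capCone q S ⊆ Metric.ball 0 1 := fun w hw => by simpa using hw.1.2
    refine (measure_mono hsub).trans ?_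
    rw [EuclideanSpace.volume_ball_fin_three, ENNReal.ofReal_one, one_pow, one_mul]
    refine ENNReal.ofReal_le_ofReal ?_
    have : 1 ≤ S ^ 2 := one_le_pow₀ h1
    nlinarith
  · set n := ⌊1 / S⌋₊ + 1 with hn
    have hnS : (n : ℝ) * S ≤ 2 := by
      have h2 : (⌊1 / S⌋₊ : ℝ) ≤ 1 / S := Nat.floor_le (by positivity)
      have h3 : (⌊1 / S⌋₊ : ℝ) * S ≤ 1 := (le_div_iff₀ hS).1 h2
      rw [hn]; push_cast; linarith
    have hsub : capCone q S ⊆ ⋃ k ∈ Finset.range n, Metric.ball (((k : ℝ) * S) • q) (2 * S) := by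
      intro w hw
      have hw0 : 0 < ‖w‖ := by linarith [hw.1.1]
      have hk1 : (⌊‖w‖ / S⌋₊ : ℝ) * S ≤ ‖w‖ := (le_div_iff₀ hS).1 (Nat.floor_le (by positivity))
      have hk2 : ‖w‖ < (⌊‖w‖ / S⌋₊ + 1 : ℝ) * S := (div_lt_iff₀ hS).1 (Nat.lt_floor_add_one _)
      rw [mem_iUnion₂]
      refine ⟨⌊‖w‖ / S⌋₊, Finset.mem_range.2 (Nat.lt_succ_of_le (Nat.floor_le_floor
        (div_le_div_of_nonneg_right hw.1.2.le hS.le))), ?_⟩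
      rw [Metric.mem_ball]
      have h2 : dist w (‖w‖ • q) < S := by
        rw [dist_normalize hw0]
        nlinarith [hw.1.2, hw.2, dist_nonneg (x := ‖w‖⁻¹ • w) (y := q)]
      have h3 : dist (‖w‖ • q) (((⌊‖w‖ / S⌋₊ : ℝ) * S) • q) ≤ S := by
        rw [dist_eq_norm, ← sub_smul, norm_smul, hq, mul_one, Real.norm_of_nonneg (by linarith)]
        linarith
      linarith [dist_triangle w (‖w‖ • q) (((⌊‖w‖ / S⌋₊ : ℝ) * S) • q)]
    refine (measure_mono hsub).trans ((measure_biUnion_finset_le _ _).trans ?_)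
    simp_rw [EuclideanSpace.volume_ball_fin_three]
    rw [Finset.sum_const, Finset.card_range, nsmul_eq_mul, ← ENNReal.ofReal_natCast,
      ← ENNReal.ofReal_pow (by positivity), ← ENNReal.ofReal_mul (by positivity),
      ← ENNReal.ofReal_mul (by positivity)]
    refine ENNReal.ofReal_le_ofReal ?_
    calc (n : ℝ) * ((2 * S) ^ 3 * (Real.pi * 4 / 3))
        = (n * S) * (8 * (Real.pi * 4 / 3) * S ^ 2) := by ring
      _ ≤ 2 * (8 * (Real.pi * 4 / 3) * S ^ 2) :=
          mul_le_mul_of_nonneg_right hnS (by positivity)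
      _ = _ := by ring

/-- The cone contains `n ≥ 2 / s` disjoint balls of radius `s / 16`, spaced by `s / 8` along the
axis at heights in `[5/8, 7/8]`. As `s ≤ 2`, they stay within norms `1 / 2` and `1`. -/
theorem le_volume_capCone (q : Space) (hq : ‖q‖ = 1) {s : ℝ} (hs : 0 < s) (hs2 : s ≤ 2) :
    ENNReal.ofReal ((Real.pi * 4 / 3) / 2048 * s ^ 2) ≤ volume (capCone q s) := by
  have hpi := Real.pi_pos
  set n := ⌊2 / s⌋₊ + 1 with hn
  have hn2 : 2 ≤ (n : ℝ) * s := by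
    have := Nat.lt_floor_add_one (2 / s)
    rw [div_lt_iff₀ hs] at this
    rw [hn]; push_cast; exact this.le
  let z : ℕ → ℝ := fun k => 5 / 8 + k * (s / 8)
  have hz1 : ∀ k, 5 / 8 ≤ z k := fun k => by simp only [z]; linarith [show 0 ≤ (k : ℝ) * (s / 8) by positivity]
  have hz2 : ∀ k ∈ Finset.range n, z k ≤ 7 / 8 := fun k hk => by
    have h1 : k ≤ ⌊2 / s⌋₊ := Nat.lt_succ_iff.1 (Finset.mem_range.1 hk)
    have h2 : (k : ℝ) * s ≤ 2 := (le_div_iff₀ hs).1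
      (le_trans (Nat.cast_le.2 h1) (Nat.floor_le (by positivity)))
    simp only [z]; linarith
  have hsub : (⋃ k ∈ Finset.range n, Metric.ball (z k • q) (s / 16)) ⊆ capCone q s := by
    intro w hw
    obtain ⟨k, hk, hwk⟩ := mem_iUnion₂.1 hw
    rw [Metric.mem_ball] at hwk
    have h1 := hz1 k
    have h2 := hz2 k hk
    have hzq : ‖z k • q‖ = z k := by rw [norm_smul, hq, mul_one, Real.norm_of_nonneg (by linarith)]
    have h3 : |‖w‖ - z k| < s / 16 := by
      have := abs_norm_sub_norm_le w (z k • q)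
      rw [hzq, ← dist_eq_norm] at this
      exact this.trans_lt hwk
    have h4 := abs_lt.1 h3
    have hw0 : 1 / 2 < ‖w‖ := by linarith
    refine ⟨⟨hw0, by linarith⟩, ?_⟩
    have h5 : dist w (‖w‖ • q) < s / 8 := by
      have h6 : dist (z k • q) (‖w‖ • q) < s / 16 := by
        rw [dist_eq_norm, ← sub_smul, norm_smul, hq, mul_one, Real.norm_eq_abs, abs_sub_comm]
        exact h3
      linarith [dist_triangle w (z k • q) (‖w‖ • q)]
    rw [dist_normalize (by linarith)] at h5
    nlinarith [dist_nonneg (x := ‖w‖⁻¹ • w) (y := q)]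
  have hdisj : (↑(Finset.range n) : Set ℕ).PairwiseDisjoint
      fun k => Metric.ball (z k • q) (s / 16) := by
    intro k _ l _ hkl
    refine Metric.ball_disjoint_ball ?_
    rw [dist_eq_norm, ← sub_smul, norm_smul, hq, mul_one, Real.norm_eq_abs]
    have h1 : z k - z l = ((k : ℝ) - l) * (s / 8) := by simp only [z]; ring
    have h2 : (1 : ℝ) ≤ |(k : ℝ) - l| := by
      have : (1 : ℤ) ≤ |(k : ℤ) - l| := Int.one_le_abs (sub_ne_zero.2 (by exact_mod_cast hkl))
      exact_mod_cast this
    rw [h1, abs_mul, abs_of_pos (by positivity : 0 < s / 8)]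
    nlinarith
  refine le_trans ?_ (measure_mono hsub)
  rw [measure_biUnion_finset hdisj fun k _ => measurableSet_ball]
  simp_rw [EuclideanSpace.volume_ball_fin_three]
  rw [Finset.sum_const, Finset.card_range, nsmul_eq_mul, ← ENNReal.ofReal_natCast,
    ← ENNReal.ofReal_pow (by positivity), ← ENNReal.ofReal_mul (by positivity),
    ← ENNReal.ofReal_mul (by positivity)]
  refine ENNReal.ofReal_le_ofReal ?_
  calc (Real.pi * 4 / 3) / 2048 * s ^ 2 = 2 * ((Real.pi * 4 / 3) / 4096 * s ^ 2) := by ring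
    _ ≤ (n * s) * ((Real.pi * 4 / 3) / 4096 * s ^ 2) :=
        mul_le_mul_of_nonneg_right hn2 (by positivity)
    _ = _ := by ring

/-- Compares the volumes of disjoint truncated cones with that of a cone containing them; the
constant is `16 * 2048`. -/
theorem sum_sq_radii_le {ι : Type*} (T : Finset ι) (q : ι → Space) (s : ι → ℝ)
    (hq : ∀ i ∈ T, ‖q i‖ = 1) (hs : ∀ i ∈ T, 0 < s i) (hs2 : ∀ i ∈ T, s i ≤ 2)
    (hdisj : ∀ i ∈ T, ∀ j ∈ T, i ≠ j → ∀ w : Space, ‖w‖ = 1 → dist w (q i) < s i →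
      ¬ dist w (q j) < s j)
    {q₀ : Space} (hq₀ : ‖q₀‖ = 1) {S : ℝ} (hS : 0 < S)
    (hsub : ∀ i ∈ T, ∀ w : Space, ‖w‖ = 1 → dist w (q i) < s i → dist w q₀ < S) :
    ∑ i ∈ T, s i ^ 2 ≤ 32768 * S ^ 2 := by
  have hpi := Real.pi_pos
  have hunit : ∀ w : Space, 1 / 2 < ‖w‖ → ‖‖w‖⁻¹ • w‖ = 1 := fun w hw => by
    rw [norm_smul, norm_inv, norm_norm, inv_mul_cancel₀ (by linarith)]
  have h1 : ∑ i ∈ T, volume (capCone (q i) (s i)) ≤ volume (capCone q₀ S) := by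
    rw [← measure_biUnion_finset (fun i hi j hj hij => ?_) fun i _ => measurableSet_capCone _ _]
    · refine measure_mono (iUnion₂_subset fun i hi w hw => ⟨hw.1, ?_⟩)
      exact hsub i hi _ (hunit w hw.1.1) hw.2
    · refine Set.disjoint_left.2 fun w hwi hwj => ?_
      exact hdisj i hi j hj hij _ (hunit w hwi.1.1) hwi.2 hwj.2
  have h2 := (Finset.sum_le_sum fun i hi =>
    le_volume_capCone (q i) (hq i hi) (hs i hi) (hs2 i hi)).trans
      (h1.trans (volume_capCone_le q₀ hq₀ hS))
  rw [← ENNReal.ofReal_sum_of_nonneg fun i _ => by positivity,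
    ENNReal.ofReal_le_ofReal_iff (by positivity), ← Finset.mul_sum] at h2
  have h3 : 0 < Real.pi * 4 / 3 := by positivity
  have h4 : (Real.pi * 4 / 3) * ∑ i ∈ T, s i ^ 2 ≤ (Real.pi * 4 / 3) * (32768 * S ^ 2) := by
    linarith
  exact le_of_mul_le_mul_left h4 h3

/-! ### Counting vertical chains in a quasisymmetric sphere -/

/-- Length-area argument. Around each image point put a cap of radius comparable to the image step
`d t k`. The caps are disjoint and lie in one ball of radius comparable to the smallest image extent
`L t₀`, so the sum of all `d t k ^ 2` is at most a constant times `L t₀ ^ 2`. Cauchy–Schwarz in each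
column gives `L t₀ ^ 2 ≤ n * ∑ d t k ^ 2`; summing over columns, `L t₀ ^ 2` cancels. -/
theorem exists_card_chains_le {X : Type*} [MetricSpace X]
    (f : X ≃ₜ Metric.sphere (0 : Space) 1) (η : ℝ≥0 → ℝ≥0)
    (hf : ∀ (x a b : X) (t : ℝ≥0), 0 < t → dist x a ≤ t * dist x b →
      dist (f x) (f a) ≤ η t * dist (f x) (f b)) (C₁ : ℝ≥0) (hC₁ : 0 < C₁) :
    ∃ C : ℝ, 0 < C ∧ ∀ (ι : Type) (T : Finset ι) (n : ℕ) (ε : ℝ) (p : ι → ℕ → X), 0 < n → 0 < ε →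
      (∀ t ∈ T, ∀ k < n, dist (p t k) (p t (k + 1)) ≤ 2 * ε) →
      (∀ t ∈ T, ∀ t' ∈ T, ∀ k ≤ n, ∀ k' ≤ n, (t ≠ t' ∨ k ≠ k') → ε ≤ dist (p t k) (p t' k')) →
      (∀ t ∈ T, ∀ t' ∈ T, ∀ k < n, ∀ y, dist (p t' k) y < ε / 2 →
        dist (p t 0) y ≤ C₁ * dist (p t 0) (p t n)) →
      (T.card : ℝ) ≤ C * n := by
  set a : ℝ := max (η 4) 1 with ha
  have ha1 : 1 ≤ a := le_max_right _ _
  set b : ℝ := η C₁ + 1 with hb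
  have hb1 : 0 < b := by positivity
  refine ⟨32768 * a ^ 2 * b ^ 2, by positivity, fun ι T n ε p hn hε h1 h2 h3 => ?_⟩
  rcases T.eq_empty_or_nonempty with rfl | hT
  · simp only [Finset.card_empty, Nat.cast_zero]; positivity
  set d : ι → ℕ → ℝ := fun t k => dist (f (p t k)) (f (p t (k + 1))) with hd
  set L : ι → ℝ := fun t => dist (f (p t 0)) (f (p t n)) with hL
  have hpos : ∀ t ∈ T, ∀ k ≤ n, ∀ k' ≤ n, k ≠ k' → 0 < dist (f (p t k)) (f (p t k')) := by
    intro t ht k hk k' hk' hkk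
    refine dist_pos.2 (f.injective.ne (dist_pos.1 ?_))
    exact hε.trans_le (h2 t ht t ht k hk k' hk' (Or.inr hkk))
  obtain ⟨t₀, ht₀, hmin⟩ := T.exists_min_image L hT
  have hL0 : 0 < L t₀ := hpos t₀ ht₀ 0 (Nat.zero_le _) n le_rfl hn.ne
  -- Steps are at most `2 * ε`, which is four times `ε / 2`; this is why `η 4` scales the caps so
  -- that they pull back into balls of radius `ε / 2`.
  have hcap : ∀ t ∈ T, ∀ k < n, ∀ w : Metric.sphere (0 : Space) 1,
      dist w (f (p t k)) < d t k / a → dist (p t k) (f.symm w) < ε / 2 := by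
    intro t ht k hk w hw
    by_contra! hge
    have h4 := hf (p t k) (p t (k + 1)) (f.symm w) 4 (by norm_num) (by
      have := h1 t ht k hk
      push_cast
      linarith)
    rw [f.apply_symm_apply, dist_comm _ w] at h4
    have h5 : (η 4 : ℝ) * dist w (f (p t k)) ≤ a * dist w (f (p t k)) :=
      mul_le_mul_of_nonneg_right (le_max_left _ _) dist_nonneg
    have h6 := (lt_div_iff₀ (by linarith : 0 < a)).1 hw
    simp only [hd] at h6
    linarith
  have hnorm : ∀ w : Metric.sphere (0 : Space) 1, ‖(w : Space)‖ = 1 := fun w => by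
    simp
  have hpack := sum_sq_radii_le (T ×ˢ Finset.range n) (fun i => (f (p i.1 i.2) : Space))
    (fun i => d i.1 i.2 / a) (fun i _ => hnorm _)
    (fun i hi => by
      rw [Finset.mem_product, Finset.mem_range] at hi
      exact div_pos (hpos i.1 hi.1 i.2 hi.2.le (i.2 + 1) hi.2 (by omega)) (by linarith))
    (fun i hi => by
      have h4 : d i.1 i.2 ≤ 2 := by
        have := dist_triangle (f (p i.1 i.2) : Space) 0 (f (p i.1 (i.2 + 1)))
        rw [dist_zero_right, dist_zero_left, hnorm, hnorm] at this
        exact this.trans (by norm_num)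
      exact (div_le_self dist_nonneg ha1).trans h4)
    (by
      intro i hi j hj hij w hw hwi hwj
      rw [Finset.mem_product, Finset.mem_range] at hi hj
      have hi' := hcap i.1 hi.1 i.2 hi.2 ⟨w, by simpa using hw⟩ hwi
      have hj' := hcap j.1 hj.1 j.2 hj.2 ⟨w, by simpa using hw⟩ hwj
      have hne : i.1 ≠ j.1 ∨ i.2 ≠ j.2 := by
        by_contra! h; exact hij (Prod.ext h.1 h.2)
      have := h2 i.1 hi.1 j.1 hj.1 i.2 hi.2.le j.2 hj.2.le hne
      linarith [dist_triangle_right (p i.1 i.2) (p j.1 j.2) (f.symm ⟨w, by simpa using hw⟩)])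
    (hnorm (f (p t₀ 0))) (mul_pos hb1 hL0)
    (by
      intro i hi w hw hwi
      rw [Finset.mem_product, Finset.mem_range] at hi
      have hi' := hcap i.1 hi.1 i.2 hi.2 ⟨w, by simpa using hw⟩ hwi
      have h4 := hf _ _ _ C₁ hC₁ (h3 t₀ ht₀ i.1 hi.1 i.2 hi.2 _ hi')
      rw [f.apply_symm_apply, dist_comm] at h4
      have h5 : dist w (f (p t₀ 0)) ≤ η C₁ * L t₀ := h4
      have h6 : b * L t₀ = η C₁ * L t₀ + L t₀ := by rw [hb]; ring
      linarith)
  have hcol : ∀ t ∈ T, L t₀ ^ 2 ≤ n * ∑ k ∈ Finset.range n, d t k ^ 2 := by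
    intro t ht
    have h4 : L t ≤ ∑ k ∈ Finset.range n, d t k :=
      dist_le_range_sum_dist (fun k => f (p t k)) n
    have h5 := sq_sum_le_card_mul_sum_sq (s := Finset.range n) (f := d t)
    rw [Finset.card_range] at h5
    exact (pow_le_pow_left₀ hL0.le ((hmin t ht).trans h4) 2).trans h5
  have hsum := Finset.sum_le_sum hcol
  rw [Finset.sum_const, nsmul_eq_mul, ← Finset.mul_sum, ← Finset.sum_product'] at hsum
  simp_rw [div_pow] at hpack
  rw [← Finset.sum_div, div_le_iff₀ (by positivity)] at hpack
  have hfin : (T.card : ℝ) * L t₀ ^ 2 ≤ (32768 * a ^ 2 * b ^ 2 * n) * L t₀ ^ 2 := by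
    refine hsum.trans ?_
    calc (n : ℝ) * _ ≤ n * (32768 * (b * L t₀) ^ 2 * a ^ 2) :=
          mul_le_mul_of_nonneg_left hpack (by positivity)
      _ = _ := by ring
  exact le_of_mul_le_mul_right hfin (by positivity)

/-! ### The geometry of a quasidisk -/

/-- The preimage of `Ω` is open and bounded with frontier the unit circle. A point of it outside the
closed disc would bring along a whole outward ray; so it meets the open disc, which is connected and
avoids the frontier. -/
theorem image_ball_subset {Ω : Set Plane} (hΩo : IsOpen Ω) (hΩn : Ω.Nonempty)
    (hΩb : Bornology.IsBounded Ω) (f : Plane ≃ₜ Plane)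
    (hf : f '' Metric.sphere (0 : Plane) 1 = frontier Ω) :
    f '' Metric.ball (0 : Plane) 1 ⊆ Ω := by
  set U : Set Plane := f ⁻¹' Ω with hU
  have hUo : IsOpen U := hΩo.preimage f.continuous
  have hfr : frontier U = Metric.sphere 0 1 := by
    rw [hU, ← f.preimage_frontier, ← hf, preimage_image_eq _ f.injective]
  have hclos : ∀ y ∈ closure U, ‖y‖ ≠ 1 → y ∈ U := fun y hy h1 => by
    by_contra hyU
    have : y ∈ frontier U := ⟨hy, by rwa [hUo.interior_eq]⟩
    rw [hfr] at this
    exact h1 (by simpa using this)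
  obtain ⟨R, hR⟩ : ∃ R, ∀ y ∈ U, ‖y‖ ≤ R := by
    have hc : IsCompact (f.symm '' closure Ω) :=
      (hΩb.isCompact_closure).image f.symm.continuous
    obtain ⟨R, hR⟩ := hc.isBounded.exists_norm_le
    exact ⟨R, fun y hy => hR y ⟨f y, subset_closure hy, f.symm_apply_apply y⟩⟩
  have hnot : ∀ u ∈ U, ¬ 1 < ‖u‖ := by
    intro u hu h1
    have hconn : IsPreconnected ((fun l : ℝ => l • u) '' Ici 1) :=
      isPreconnected_Ici.image _ (by fun_prop)
    have hsub := hconn.subset_of_closure_inter_subset hUo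
      ⟨u, ⟨1, self_mem_Ici, one_smul _ _⟩, hu⟩ (by
        rintro _ ⟨hy, l, hl, rfl⟩
        refine hclos _ hy (ne_of_gt ?_)
        have hl' : (1 : ℝ) ≤ l := hl
        show 1 < ‖l • u‖
        rw [norm_smul, Real.norm_of_nonneg (by linarith)]
        nlinarith)
    have h2 := hR _ (hsub ⟨max R 1 + 1, by
      rw [mem_Ici]; linarith [le_max_right R 1], rfl⟩)
    simp only at h2
    have h3 : 0 ≤ max R 1 + 1 := by linarith [le_max_right R 1]
    rw [norm_smul, Real.norm_of_nonneg h3] at h2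
    nlinarith [le_max_left R 1]
  obtain ⟨v, hv⟩ := hΩn
  have huU : f.symm v ∈ U := by rw [hU, mem_preimage, f.apply_symm_apply]; exact hv
  have hu1 : ‖f.symm v‖ < 1 := by
    refine lt_of_le_of_ne (not_lt.1 (hnot _ huU)) fun h => ?_
    have h2 : f.symm v ∈ frontier U := by rw [hfr]; simpa using h
    exact (hUo.inter_frontier_eq.subset ⟨huU, h2⟩).elim
  have hball : Metric.ball (0 : Plane) 1 ⊆ U :=
    (convex_ball _ _).isPreconnected.subset_of_closure_inter_subset hUo
      ⟨f.symm v, by simpa using hu1, huU⟩ fun y hy =>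
        hclos y hy.1 (ne_of_lt (by simpa using hy.2))
  rintro _ ⟨y, hy, rfl⟩
  exact hball hy

/-- Take the image of a point on the radius to `a'`. Among points of the circle `a'` is nearest to
it, and weak quasisymmetry preserves this up to the factor `H`. Radii up to the distance from `f 0`
to the boundary are reached. -/
theorem exists_corkscrew {Ω : Set Plane} (hΩo : IsOpen Ω) (hΩn : Ω.Nonempty)
    (hΩb : Bornology.IsBounded Ω) (f : Plane ≃ₜ Plane)
    (hf : f '' Metric.sphere (0 : Plane) 1 = frontier Ω) {H : ℝ} (hH : 1 ≤ H)
    (hw : ∀ x a b : Plane, dist x a ≤ dist x b → dist (f x) (f a) ≤ H * dist (f x) (f b)) :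
    ∃ R₀ > 0, ∀ a ∈ frontier Ω, ∀ R, 0 < R → R ≤ R₀ →
      ∃ p ∈ Ω, dist p a ≤ R ∧ R ≤ H * Metric.infDist p (frontier Ω) := by
  have hball := image_ball_subset hΩo hΩn hΩb f hf
  have hfr : (frontier Ω).Nonempty := by
    rw [← hf]
    exact (NormedSpace.sphere_nonempty.2 zero_le_one).image f
  have h0 : f 0 ∉ frontier Ω := fun h =>
    (hΩo.inter_frontier_eq.subset ⟨hball ⟨0, by simp, rfl⟩, h⟩).elim
  refine ⟨Metric.infDist (f 0) (frontier Ω),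
    (isClosed_frontier.notMem_iff_infDist_pos hfr).1 h0, fun a ha R hR hR0 => ?_⟩
  have ha' := ha
  rw [← hf] at ha'
  obtain ⟨a', ha1, rfl⟩ := ha'
  have hna : ‖a'‖ = 1 := by simpa using ha1
  have hc : Continuous fun s : ℝ => dist (f (s • a')) (f a') := by
    have := f.continuous
    fun_prop
  obtain ⟨s, hs, hsR⟩ := intermediate_value_Icc' zero_le_one hc.continuousOn
    (show R ∈ Icc _ _ from ⟨by simpa using hR.le, by
      rw [zero_smul]; exact hR0.trans (Metric.infDist_le_dist_of_mem ha)⟩)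
  simp only at hsR
  have hs1 : s < 1 := lt_of_le_of_ne hs.2 fun h => by
    rw [h, one_smul, dist_self] at hsR; exact hR.ne hsR
  refine ⟨f (s • a'), hball ⟨_, ?_, rfl⟩, hsR.le, ?_⟩
  · rw [mem_ball_zero_iff, norm_smul, hna, mul_one, Real.norm_of_nonneg hs.1]; exact hs1
  · have hHpos : 0 < H := by linarith
    rw [← div_le_iff₀' hHpos]
    refine (Metric.le_infDist hfr).2 fun w hwm => ?_
    rw [← hf] at hwm
    obtain ⟨w', hw', rfl⟩ := hwm
    have hnw : ‖w'‖ = 1 := by simpa using hw'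
    rw [div_le_iff₀' hHpos, ← hsR]
    refine hw _ _ _ ?_
    have h1 : dist (s • a') a' = 1 - s := by
      nth_rewrite 2 [← one_smul ℝ a']
      rw [dist_eq_norm, ← sub_smul, norm_smul, hna, mul_one, Real.norm_eq_abs, abs_sub_comm,
        abs_of_nonneg (by linarith)]
    have h2 : 1 - s ≤ dist (s • a') w' := by
      have := norm_sub_norm_le w' (s • a')
      rw [norm_smul, hna, hnw, mul_one, Real.norm_of_nonneg hs.1, ← dist_eq_norm, dist_comm] at this
      exact this
    rw [h1]; exact h2

/-- Distance to the boundary is `1`-Lipschitz, so on the segment from `p` to its nearest boundary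
point it must decrease at full speed. It is positive off the foot, which keeps the segment inside
`Ω`. -/
theorem exists_normal_segment {Ω : Set Plane} (hΩo : IsOpen Ω) (hfr : (frontier Ω).Nonempty)
    {p : Plane} (hp : p ∈ Ω) :
    ∃ x ∈ frontier Ω, dist x p = Metric.infDist p (frontier Ω) ∧ ∃ u : Plane, ‖u‖ = 1 ∧
      ∀ s, 0 ≤ s → s ≤ Metric.infDist p (frontier Ω) →
        x + s • u ∈ closure Ω ∧ Metric.infDist (x + s • u) (frontier Ω) = s := by
  obtain ⟨x, hx, hxp⟩ := isClosed_frontier.exists_infDist_eq_dist hfr p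
  have hne : p ≠ x := by
    rintro rfl
    exact (hΩo.inter_frontier_eq.subset ⟨hp, hx⟩).elim
  set ρ := Metric.infDist p (frontier Ω) with hρ
  have hρ0 : 0 < ρ := by rw [hxp]; exact dist_pos.2 hne
  set u : Plane := ρ⁻¹ • (p - x) with hu
  have hu1 : ‖u‖ = 1 := by
    rw [hu, norm_smul, ← dist_eq_norm, ← hxp, Real.norm_of_nonneg (by positivity),
      inv_mul_cancel₀ hρ0.ne']
  have hpu : p = x + ρ • u := by rw [hu, smul_inv_smul₀ hρ0.ne']; abel
  have hdist : ∀ s, 0 ≤ s → s ≤ ρ → Metric.infDist (x + s • u) (frontier Ω) = s := by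
    intro s h0 hs
    refine le_antisymm ?_ ?_
    · refine (Metric.infDist_le_dist_of_mem hx).trans ?_
      rw [dist_eq_norm, add_sub_cancel_left, norm_smul, hu1, mul_one, Real.norm_of_nonneg h0]
    · have h1 := Metric.infDist_le_infDist_add_dist (s := frontier Ω) (x := p) (y := x + s • u)
      have h2 : dist p (x + s • u) = ρ - s := by
        conv_lhs => rw [hpu]
        rw [dist_add_left, dist_eq_norm, ← sub_smul, norm_smul, hu1, mul_one,
          Real.norm_of_nonneg (by linarith)]
      rw [h2, ← hρ] at h1
      linarith
  refine ⟨x, hx, by rw [dist_comm, hxp], u, hu1, fun s h0 hs => ⟨?_, hdist s h0 hs⟩⟩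
  rcases h0.eq_or_lt with rfl | h0
  · rw [zero_smul, add_zero]; exact frontier_subset_closure hx
  · have hconn : IsPreconnected ((fun r : ℝ => x + r • u) '' Icc s ρ) :=
      isPreconnected_Icc.image _ (by fun_prop)
    have hsub := hconn.subset_of_closure_inter_subset hΩo
      ⟨p, ⟨ρ, ⟨hs, le_rfl⟩, hpu.symm⟩, hp⟩ (by
        rintro _ ⟨hy, r, hr, rfl⟩
        by_contra hyΩ
        have hyf : x + r • u ∈ frontier Ω := ⟨hy, by rwa [hΩo.interior_eq]⟩
        have h3 := hdist r (h0.le.trans hr.1) hr.2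
        rw [Metric.infDist_zero_of_mem hyf] at h3
        linarith [hr.1])
    exact subset_closure (hsub ⟨s, ⟨le_rfl, hs⟩, rfl⟩)

/-! ### Points of the surface above the plane -/

/-- The point of space above `w` at height `h`. -/
noncomputable def lift (w : Plane) (h : ℝ) : Space := !₂[w 0, w 1, h]

theorem dist_lift_sq (w w' : Plane) (h h' : ℝ) :
    dist (lift w h) (lift w' h') ^ 2 = dist w w' ^ 2 + |h - h'| ^ 2 := by
  rw [EuclideanSpace.dist_eq, EuclideanSpace.dist_eq,
    Real.sq_sqrt (Finset.sum_nonneg fun _ _ => sq_nonneg _),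
    Real.sq_sqrt (Finset.sum_nonneg fun _ _ => sq_nonneg _), Fin.sum_univ_three, Fin.sum_univ_two]
  simp [lift, Real.dist_eq]

theorem le_of_sq_le {a b : ℝ} (h : a ^ 2 ≤ b ^ 2) (hb : 0 ≤ b) : a ≤ b :=
  (abs_le_of_sq_le_sq' h hb).2

theorem dist_le_dist_lift (w w' : Plane) (h h' : ℝ) :
    dist w w' ≤ dist (lift w h) (lift w' h') :=
  le_of_sq_le (by rw [dist_lift_sq]; nlinarith [sq_nonneg |h - h'|]) dist_nonneg

theorem abs_sub_le_dist_lift (w w' : Plane) (h h' : ℝ) :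
    |h - h'| ≤ dist (lift w h) (lift w' h') :=
  le_of_sq_le (by rw [dist_lift_sq]; nlinarith [sq_nonneg (dist w w')]) dist_nonneg

theorem dist_lift_le (w w' : Plane) (h h' : ℝ) :
    dist (lift w h) (lift w' h') ≤ dist w w' + |h - h'| :=
  le_of_sq_le (by
    rw [dist_lift_sq]
    nlinarith [mul_nonneg (dist_nonneg (x := w) (y := w')) (abs_nonneg (h - h'))])
    (add_nonneg dist_nonneg (abs_nonneg _))

theorem lift_mem_surface {Ω : Set Plane} {α : ℝ} {w : Plane} (hw : w ∈ closure Ω) {h : ℝ}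
    (hh : h = Metric.infDist w (frontier Ω) ^ α) : lift w h ∈ surface Ω α :=
  ⟨w, hw, rfl, rfl, Or.inl hh⟩

/-! ### Separated sets on the boundary -/

/-- Every `δ`-separated subset of `Γ` in a ball of radius `r ≤ r₀` has at most `C r / δ` points,
as long as `δ` is at least `lam * r ^ β`. -/
def SeparationBound (Γ : Set Plane) (r₀ β : ℝ) : Prop :=
  ∃ C > (0 : ℝ), ∃ lam > (0 : ℝ), ∀ (a : Plane) (r δ : ℝ), 0 < r → r ≤ r₀ → 0 < δ →
    lam * r ^ β ≤ δ → δ ≤ r → ∀ T : Finset Plane, (T : Set Plane) ⊆ Γ →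
      (∀ t ∈ T, dist t a ≤ r) → (∀ t ∈ T, ∀ t' ∈ T, t ≠ t' → δ ≤ dist t t') →
      (T.card : ℝ) ≤ C * (r / δ)

/-- Each point `t` of the set gets a column over a normal segment whose foot is near `t`. With `δ =
lam * ε`, the condition on `δ` gives `r ^ (1 / α) ≤ ε`, so a column of height about `r` drifts
horizontally by at most `ε`. -/
theorem exists_separationBound {Ω : Set Plane} {α : ℝ} (hα₀ : 0 < α) (hΩo : IsOpen Ω)
    (hfr : (frontier Ω).Nonempty) {H R₀ : ℝ} (hH : 1 ≤ H) (hR₀ : 0 < R₀)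
    (hcork : ∀ a ∈ frontier Ω, ∀ R, 0 < R → R ≤ R₀ →
      ∃ p ∈ Ω, dist p a ≤ R ∧ R ≤ H * Metric.infDist p (frontier Ω))
    (hqs : IsQuasisymmetricTo (surface Ω α) (Metric.sphere (0 : Space) 1)) :
    ∃ r₀ > 0, SeparationBound (frontier Ω) r₀ (1 / α) := by
  obtain ⟨f, η, hf⟩ := hqs
  set C₁ : ℝ≥0 := ⟨8 * H + 12, by linarith⟩ with hC₁
  obtain ⟨C, hC, hcount⟩ := exists_card_chains_le f η hf C₁ (by
    rw [← NNReal.coe_pos]; show 0 < 8 * H + 12; linarith)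
  -- Column points lie within `(2 * H + 1) * ε` of their `t`, so distinct columns stay `lam * ε - 2
  -- * (2 * H + 1) * ε = ε` apart.
  set lam : ℝ := 4 * H + 3 with hlam
  have hlam0 : 0 < lam := by linarith
  have hH0 : 0 < H := by linarith
  refine ⟨R₀ / H, by positivity, C * lam, by positivity, lam, hlam0, ?_⟩
  intro a r δ hr hr0 hδ hlamδ hδr T hTΓ hTa hTsep
  set ε := δ / lam with hε
  have hε0 : 0 < ε := by positivity
  have hδε : δ = lam * ε := by rw [hε]; field_simp
  have hεr : ε ≤ r := (div_le_self hδ.le (by linarith)).trans hδr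
  set τ := r ^ (1 / α) with hτ
  have hτε : τ ≤ ε := by rw [hε, le_div_iff₀ hlam0]; linarith
  have hHε : H * ε ≤ R₀ := by
    rw [le_div_iff₀ hH0] at hr0
    nlinarith
  have hfoot : ∀ t : Plane, ∃ x u : Plane, t ∈ T → dist x t ≤ 2 * H * ε ∧ ‖u‖ = 1 ∧
      ∀ s, 0 ≤ s → s ≤ τ → x + s • u ∈ closure Ω ∧
        Metric.infDist (x + s • u) (frontier Ω) = s := by
    intro t
    by_cases ht : t ∈ T
    · obtain ⟨p, hp, hpt, hpd⟩ := hcork t (hTΓ ht) (H * ε) (by positivity) hHε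
      obtain ⟨x, hx, hxp, u, hu, hseg⟩ := exists_normal_segment hΩo hfr hp
      have hεd : ε ≤ Metric.infDist p (frontier Ω) := le_of_mul_le_mul_left hpd hH0
      refine ⟨x, u, fun _ => ⟨?_, hu, fun s h0 hs => hseg s h0 (hs.trans (hτε.trans hεd))⟩⟩
      have h1 := Metric.infDist_le_dist_of_mem (x := p) (hTΓ ht)
      linarith [dist_triangle x p t]
    · exact ⟨0, 0, fun h => absurd h ht⟩
  choose x u hxu using hfoot
  set n := ⌊r / ε⌋₊ with hn
  have hn0 : 0 < n := Nat.floor_pos.2 ((one_le_div hε0).2 hεr)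
  have hnr : (n : ℝ) * ε ≤ r := (le_div_iff₀ hε0).1 (Nat.floor_le (by positivity))
  have hrn : r ≤ 2 * (n * ε) := by
    have h1 := (div_lt_iff₀ hε0).1 (Nat.lt_floor_add_one (r / ε))
    have h2 : (1 : ℝ) ≤ n := by exact_mod_cast hn0
    rw [← hn] at h1
    nlinarith
  -- The distance to the boundary at which the surface has height `k * ε`.
  let sk : ℕ → ℝ := fun k => ((k : ℝ) * ε) ^ (1 / α)
  have hsk0 : ∀ k, 0 ≤ sk k := fun k => by positivity
  have hskτ : ∀ k ≤ n, sk k ≤ τ := fun k hk => by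
    refine Real.rpow_le_rpow (by positivity) (le_trans ?_ hnr) (by positivity)
    exact mul_le_mul_of_nonneg_right (by exact_mod_cast hk) hε0.le
  have hskα : ∀ k, sk k ^ α = k * ε := fun k => by
    simp only [sk]
    rw [← Real.rpow_mul (by positivity), one_div_mul_cancel hα₀.ne', Real.rpow_one]
  let w : Plane → ℕ → Plane := fun t k => x t + sk k • u t
  have hmem : ∀ t ∈ T, ∀ k ≤ n, lift (w t k) (k * ε) ∈ surface Ω α := fun t ht k hk => by
    obtain ⟨h1, h2⟩ := (hxu t ht).2.2 (sk k) (hsk0 k) (hskτ k hk)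
    exact lift_mem_surface h1 (by rw [h2, hskα])
  obtain ⟨b, hb⟩ := hfr
  have hbm : lift b (Metric.infDist b (frontier Ω) ^ α) ∈ surface Ω α :=
    lift_mem_surface (frontier_subset_closure hb) rfl
  classical
  let p : Plane → ℕ → surface Ω α := fun t k =>
    if h : t ∈ T ∧ k ≤ n then ⟨lift (w t k) (k * ε), hmem t h.1 k h.2⟩ else ⟨_, hbm⟩
  have hp : ∀ t ∈ T, ∀ k ≤ n, (p t k : Space) = lift (w t k) (k * ε) := fun t ht k hk => by
    simp only [p]
    rw [dif_pos ⟨ht, hk⟩]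
  have hwt : ∀ t ∈ T, ∀ k ≤ n, dist (w t k) t ≤ (2 * H + 1) * ε := fun t ht k hk => by
    have h1 : dist (w t k) (x t) ≤ ε := by
      simp only [w]
      rw [dist_eq_norm, add_sub_cancel_left, norm_smul, (hxu t ht).2.1, mul_one,
        Real.norm_of_nonneg (hsk0 k)]
      exact (hskτ k hk).trans hτε
    linarith [dist_triangle (w t k) (x t) t, (hxu t ht).1]
  have hcard := hcount Plane T n ε p hn0 hε0 ?_ ?_ ?_
  · refine hcard.trans ?_
    have h1 : (n : ℝ) ≤ r / ε := (le_div_iff₀ hε0).2 hnr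
    calc C * (n : ℝ) ≤ C * (r / ε) := mul_le_mul_of_nonneg_left h1 hC.le
      _ = C * lam * (r / δ) := by rw [hδε]; field_simp
  · intro t ht k hk
    rw [Subtype.dist_eq, hp t ht k hk.le, hp t ht (k + 1) hk]
    refine (dist_lift_le _ _ _ _).trans ?_
    have h1 : dist (w t k) (w t (k + 1)) ≤ ε := by
      simp only [w]
      rw [dist_add_left, dist_eq_norm, ← sub_smul, norm_smul, (hxu t ht).2.1, mul_one,
        Real.norm_eq_abs, abs_le]
      constructor <;> linarith [hsk0 k, hsk0 (k + 1), hskτ k hk.le, hskτ (k + 1) hk]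
    have h2 : |(k : ℝ) * ε - ((k + 1 : ℕ) : ℝ) * ε| = ε := by
      push_cast
      rw [show (k : ℝ) * ε - (k + 1) * ε = -ε by ring, abs_neg, abs_of_pos hε0]
    linarith
  · intro t ht t' ht' k hk k' hk' hne
    rw [Subtype.dist_eq, hp t ht k hk, hp t' ht' k' hk']
    by_cases htt : t = t'
    · have hkk : k ≠ k' := hne.resolve_left (not_not.2 htt)
      refine le_trans ?_ (abs_sub_le_dist_lift _ _ _ _)
      have h2 : (1 : ℝ) ≤ |(k : ℝ) - k'| := by
        have : (1 : ℤ) ≤ |(k : ℤ) - k'| := Int.one_le_abs (sub_ne_zero.2 (by exact_mod_cast hkk))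
        exact_mod_cast this
      rw [← sub_mul, abs_mul, abs_of_pos hε0]
      nlinarith
    · refine le_trans ?_ (dist_le_dist_lift _ _ _ _)
      have h1 := hTsep t ht t' ht' htt
      have h2 := hwt t ht k hk
      have h3 := hwt t' ht' k' hk'
      have h4 := dist_triangle4 t (w t k) (w t' k') t'
      rw [dist_comm t (w t k)] at h4
      rw [hδε, hlam] at h1
      nlinarith
  · intro t ht t' ht' k hk y hy
    have h5 : r / 2 ≤ dist (p t 0) (p t n) := by
      rw [Subtype.dist_eq, hp t ht 0 (Nat.zero_le _), hp t ht n le_rfl]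
      refine le_trans ?_ (abs_sub_le_dist_lift _ _ _ _)
      rw [Nat.cast_zero, zero_mul, zero_sub, abs_neg, abs_of_nonneg (by positivity)]
      linarith
    have h6 : dist (p t 0) (p t' k) ≤ (2 * r + 2 * ((2 * H + 1) * ε)) + r := by
      rw [Subtype.dist_eq, hp t ht 0 (Nat.zero_le _), hp t' ht' k hk.le]
      refine (dist_lift_le _ _ _ _).trans (add_le_add ?_ ?_)
      · have h2 := hwt t ht 0 (Nat.zero_le _)
        have h3 := hwt t' ht' k hk.le
        have h4 := dist_triangle4 (w t 0) t t' (w t' k)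
        rw [dist_comm t' (w t' k)] at h4
        linarith [dist_triangle_right t t' a, hTa t ht, hTa t' ht']
      · rw [Nat.cast_zero, zero_mul, zero_sub, abs_neg, abs_of_nonneg (by positivity)]
        have : (k : ℝ) ≤ n := by exact_mod_cast hk.le
        nlinarith
    have h7 : dist (p t 0) y ≤ (4 * H + 6) * r := by
      have := dist_triangle (p t 0) (p t' k) y
      nlinarith
    show dist (p t 0) y ≤ (8 * H + 12) * dist (p t 0) (p t n)
    nlinarith

/-! ### Improving the exponent -/

theorem exists_maximal_separated (T : Finset Plane) {s : ℝ} (hs : 0 < s) :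
    ∃ T' ⊆ T, (∀ t ∈ T', ∀ t' ∈ T', t ≠ t' → s ≤ dist t t') ∧
      ∀ t ∈ T, ∃ t' ∈ T', dist t t' ≤ s := by
  classical
  let S := T.powerset.filter fun A => ∀ t ∈ A, ∀ t' ∈ A, t ≠ t' → s ≤ dist t t'
  have hS : S.Nonempty := ⟨∅, by simp [S]⟩
  obtain ⟨T', hT', hmax⟩ := S.exists_max_image Finset.card hS
  rw [Finset.mem_filter, Finset.mem_powerset] at hT'
  refine ⟨T', hT'.1, hT'.2, fun t ht => ?_⟩
  by_contra! hfar
  have htT' : t ∉ T' := fun h => by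
    have := hfar t h
    rw [dist_self] at this
    linarith
  have hmem : insert t T' ∈ S := by
    rw [Finset.mem_filter, Finset.mem_powerset]
    refine ⟨Finset.insert_subset ht hT'.1, fun a ha b hb hab => ?_⟩
    rw [Finset.mem_insert] at ha hb
    rcases ha with rfl | ha <;> rcases hb with rfl | hb
    · exact absurd rfl hab
    · exact (hfar b hb).le
    · rw [dist_comm]; exact (hfar a ha).le
    · exact hT'.2 a ha b hb hab
  have := hmax _ hmem
  rw [Finset.card_insert_of_notMem htT'] at this
  omega

/-- At the intermediate scale `s = lam' * r ^ β'` a maximal `s`-separated subset has at most `C' *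
(r / s)` points, and each disc of radius `s` holds at most `C * (s / δ)` points of `T`; `s` cancels
in the product. When `s` is not between `δ` and `r`, one of the two bounds applies directly. -/
theorem SeparationBound.comp {Γ : Set Plane} {r₀ β β' : ℝ} (hβ : 0 < β)
    (h : SeparationBound Γ r₀ β) (h' : SeparationBound Γ r₀ β') :
    SeparationBound Γ r₀ (β' * β) := by
  classical
  obtain ⟨C, hC, lam, hlam, hb⟩ := h
  obtain ⟨C', hC', lam', hlam', hb'⟩ := h'
  refine ⟨C + C' + C' * C, by positivity, lam * lam' ^ β, by positivity, ?_⟩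
  intro a r δ hr hr0 hδ hlδ hδr T hTΓ hTa hTs
  have hq : 0 < r / δ := by positivity
  set s := lam' * r ^ β' with hs
  have hs0 : 0 < s := by positivity
  have hsβ : lam * s ^ β ≤ δ := by
    rw [hs, Real.mul_rpow hlam'.le (by positivity), ← Real.rpow_mul hr.le, ← mul_assoc]
    exact hlδ
  rcases le_or_gt r s with hrs | hsr
  · have h1 := hb a r δ hr hr0 hδ (le_trans (mul_le_mul_of_nonneg_left
      (Real.rpow_le_rpow hr.le hrs hβ.le) hlam.le) hsβ) hδr T hTΓ hTa hTs
    refine h1.trans (mul_le_mul_of_nonneg_right ?_ hq.le)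
    nlinarith
  rcases le_or_gt s δ with hsδ | hδs
  · have h1 := hb' a r δ hr hr0 hδ hsδ hδr T hTΓ hTa hTs
    refine h1.trans (mul_le_mul_of_nonneg_right ?_ hq.le)
    nlinarith
  obtain ⟨T', hT'T, hT's, hT'c⟩ := exists_maximal_separated T hs0
  have h1 := hb' a r s hr hr0 hs0 le_rfl hsr.le T' (fun t ht => hTΓ (hT'T ht))
    (fun t ht => hTa t (hT'T ht)) hT's
  have h2 : ∀ b ∈ T', ((T.filter fun t => dist t b ≤ s).card : ℝ) ≤ C * (s / δ) := by
    intro b _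
    refine hb b s δ hs0 (hsr.le.trans hr0) hδ hsβ hδs.le _
      (fun t ht => hTΓ (Finset.mem_of_mem_filter t ht)) (fun t ht => (Finset.mem_filter.1 ht).2)
      fun t ht t' ht' => hTs t (Finset.mem_of_mem_filter t ht) t' (Finset.mem_of_mem_filter t' ht')
  have hcov : T ⊆ T'.biUnion fun b => T.filter fun t => dist t b ≤ s := fun t ht => by
    obtain ⟨b, hbT, hbt⟩ := hT'c t ht
    exact Finset.mem_biUnion.2 ⟨b, hbT, Finset.mem_filter.2 ⟨ht, hbt⟩⟩
  have h3 : (T.card : ℝ) ≤ ∑ b ∈ T', ((T.filter fun t => dist t b ≤ s).card : ℝ) := by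
    exact_mod_cast (Finset.card_le_card hcov).trans Finset.card_biUnion_le
  calc (T.card : ℝ) ≤ ∑ b ∈ T', ((T.filter fun t => dist t b ≤ s).card : ℝ) := h3
    _ ≤ T'.card * (C * (s / δ)) := by
        rw [← nsmul_eq_mul]; exact Finset.sum_le_card_nsmul _ _ _ h2
    _ ≤ C' * (r / s) * (C * (s / δ)) := mul_le_mul_of_nonneg_right h1 (by positivity)
    _ = C' * C * (r / δ) := by field_simp
    _ ≤ (C + C' + C' * C) * (r / δ) :=
        mul_le_mul_of_nonneg_right (by linarith) hq.le

theorem SeparationBound.pow {Γ : Set Plane} {r₀ β : ℝ} (hβ : 0 < β)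
    (h : SeparationBound Γ r₀ β) (k : ℕ) : SeparationBound Γ r₀ (β ^ (k + 1)) := by
  induction k with
  | zero => simpa using h
  | succ k ih => rw [pow_succ]; exact h.comp hβ ih

theorem exists_card_separated_le {Γ : Set Plane} (hΓ : IsCompact Γ) {s : ℝ} (hs : 0 < s) :
    ∃ M : ℕ, ∀ T : Finset Plane, (T : Set Plane) ⊆ Γ →
      (∀ t ∈ T, ∀ t' ∈ T, t ≠ t' → s ≤ dist t t') → T.card ≤ M := by
  classical
  obtain ⟨A, hA, hcov⟩ := Metric.totallyBounded_iff.1 hΓ.totallyBounded (s / 2) (half_pos hs)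
  refine ⟨hA.toFinset.card, fun T hT hsep => ?_⟩
  have hex : ∀ t ∈ T, ∃ y ∈ hA.toFinset, dist t y < s / 2 := fun t ht => by
    obtain ⟨y, hy, hty⟩ := mem_iUnion₂.1 (hcov (hT ht))
    exact ⟨y, hA.mem_toFinset.2 hy, hty⟩
  choose! g hg hgd using hex
  refine Finset.card_le_card_of_injOn g hg fun t ht t' ht' h => ?_
  by_contra hne
  have h1 := hsep t ht t' ht' hne
  have h2 := hgd t' ht'
  rw [← h] at h2
  linarith [dist_triangle_right t t' (g t), hgd t ht]

/-! ### The partition of a subarc -/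

theorem mem_arcEndpoints_image_Icc {G : ℝ → Plane} (hG : Continuous G) (hinj : InjOn G (Icc 0 1))
    {a b : ℝ} (ha : 0 ≤ a) (hab : a < b) (hb : b ≤ 1) :
    IsJordanArc (G '' Icc a b) ∧ G a ∈ arcEndpoints (G '' Icc a b) ∧
      G b ∈ arcEndpoints (G '' Icc a b) := by
  have hba : 0 < b - a := sub_pos.2 hab
  have hmem : ∀ u : unitInterval, a + u * (b - a) ∈ Icc a b := fun u => by
    have h0 : (0 : ℝ) ≤ u := u.2.1
    have h1 : (u : ℝ) ≤ 1 := u.2.2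
    constructor <;> nlinarith
  have hmem' : ∀ u : unitInterval, b - u * (b - a) ∈ Icc a b := fun u => by
    have h0 : (0 : ℝ) ≤ u := u.2.1
    have h1 : (u : ℝ) ≤ 1 := u.2.2
    constructor <;> nlinarith
  have hsub : Icc a b ⊆ Icc 0 1 := Icc_subset_Icc ha hb
  have h1 : IsArcFromTo (G '' Icc a b) (G a) (G b) := by
    refine ⟨fun u => G (a + u * (b - a)), hG.comp (by fun_prop), fun u v h => ?_, ?_, by simp,
      by simp⟩
    · have := hinj (hsub (hmem u)) (hsub (hmem v)) h
      exact Subtype.ext (mul_right_cancel₀ hba.ne' (add_left_cancel this))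
    · refine Subset.antisymm ?_ ?_
      · rintro _ ⟨u, rfl⟩; exact mem_image_of_mem _ (hmem u)
      · rintro _ ⟨y, hy, rfl⟩
        refine ⟨⟨(y - a) / (b - a), div_nonneg (sub_nonneg.2 hy.1) hba.le,
          (div_le_one hba).2 (by linarith [hy.2])⟩, ?_⟩
        simp only
        rw [div_mul_cancel₀ _ hba.ne', add_sub_cancel]
  have h2 : IsArcFromTo (G '' Icc a b) (G b) (G a) := by
    refine ⟨fun u => G (b - u * (b - a)), hG.comp (by fun_prop), fun u v h => ?_, ?_, by simp,
      by simp⟩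
    · have := hinj (hsub (hmem' u)) (hsub (hmem' v)) h
      exact Subtype.ext (mul_right_cancel₀ hba.ne' (sub_right_injective this))
    · refine Subset.antisymm ?_ ?_
      · rintro _ ⟨u, rfl⟩; exact mem_image_of_mem _ (hmem' u)
      · rintro _ ⟨y, hy, rfl⟩
        refine ⟨⟨(b - y) / (b - a), div_nonneg (sub_nonneg.2 hy.2) hba.le,
          (div_le_one hba).2 (by linarith [hy.1])⟩, ?_⟩
        simp only
        rw [div_mul_cancel₀ _ hba.ne', sub_sub_cancel]
  exact ⟨⟨_, _, h1⟩, ⟨_, h1⟩, ⟨_, h2⟩⟩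

theorem monotone_cuts {t : ℕ → ℝ} {N : ℕ} (h : ∀ i < N, t i < t (i + 1)) {i j : ℕ} (hij : i ≤ j)
    (hj : j ≤ N) : t i ≤ t j := by
  induction j, hij using Nat.le_induction with
  | base => exact le_rfl
  | succ j hij ih => exact (ih (by omega)).trans (h j (by omega)).le

/-- The pieces of an arc determined by finitely many cuts. -/
noncomputable def cutPieces (G : ℝ → Plane) (t : ℕ → ℝ) (N : ℕ) : Finset (Set Plane) := by
  classical exact (Finset.range N).image fun i => G '' Icc (t i) (t (i + 1))

theorem mem_cutPieces {G : ℝ → Plane} {t : ℕ → ℝ} {N : ℕ} {A : Set Plane} :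
    A ∈ cutPieces G t N ↔ ∃ i < N, G '' Icc (t i) (t (i + 1)) = A := by
  simp [cutPieces]

theorem card_cutPieces_le (G : ℝ → Plane) (t : ℕ → ℝ) (N : ℕ) : (cutPieces G t N).card ≤ N := by
  classical
  exact Finset.card_image_le.trans (Finset.card_range N).le

theorem isPartition_cutPieces {G : ℝ → Plane} (hG : Continuous G) (hinj : InjOn G (Icc 0 1))
    {t : ℕ → ℝ} {N : ℕ} (t0 : t 0 = 0) (tN : t N = 1) (ht : ∀ i < N, t i < t (i + 1)) :
    IsPartition (G '' Icc 0 1) (cutPieces G t N) := by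
  have hnn : ∀ i ≤ N, 0 ≤ t i := fun i hi => by
    rw [← t0]; exact monotone_cuts ht (Nat.zero_le _) hi
  have hle : ∀ i ≤ N, t i ≤ 1 := fun i hi => by
    rw [← tN]; exact monotone_cuts ht hi le_rfl
  have hends := fun i (hi : i < N) =>
    mem_arcEndpoints_image_Icc hG hinj (hnn i hi.le) (ht i hi) (hle (i + 1) hi)
  have hmeet : ∀ i j, i < j → j < N → G '' Icc (t i) (t (i + 1)) ∩ G '' Icc (t j) (t (j + 1)) ⊆
      arcEndpoints (G '' Icc (t i) (t (i + 1))) ∩ arcEndpoints (G '' Icc (t j) (t (j + 1))) := by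
    rintro i j hij hj _ ⟨⟨u, hu, rfl⟩, ⟨v, hv, hvu⟩⟩
    have hi : i < N := hij.trans hj
    have h1 : v = u := hinj ⟨(hnn j hj.le).trans hv.1, hv.2.trans (hle _ hj)⟩
      ⟨(hnn i hi.le).trans hu.1, hu.2.trans (hle _ hi)⟩ hvu
    subst h1
    have h2 := monotone_cuts ht (show i + 1 ≤ j from hij) hj.le
    have h3 : v = t (i + 1) := le_antisymm hu.2 (h2.trans hv.1)
    have h4 : v = t j := le_antisymm (hu.2.trans h2) hv.1
    refine ⟨?_, ?_⟩
    · rw [h3]; exact (hends i hi).2.2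
    · rw [h4]; exact (hends j hj).2.1
  refine ⟨fun A hA => ?_, fun A hA B hB hAB => ?_, ?_⟩
  · obtain ⟨i, hi, rfl⟩ := mem_cutPieces.1 hA
    exact (hends i hi).1
  · obtain ⟨i, hi, rfl⟩ := mem_cutPieces.1 hA
    obtain ⟨j, hj, rfl⟩ := mem_cutPieces.1 hB
    rcases lt_trichotomy i j with h | rfl | h
    · exact hmeet i j h hj
    · exact absurd rfl hAB
    · rw [inter_comm, inter_comm (arcEndpoints _)]; exact hmeet j i h hi
  · refine Subset.antisymm (iUnion₂_subset fun A hA => ?_) ?_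
    · obtain ⟨i, hi, rfl⟩ := mem_cutPieces.1 hA
      exact image_mono (Icc_subset_Icc (hnn i hi.le) (hle (i + 1) hi))
    -- The alternative `y = t 0` is needed to start the induction, where there are no pieces yet.
    · have hcov : ∀ m ≤ N, Icc (t 0) (t m) ⊆ {y | y = t 0 ∨ ∃ i < N, y ∈ Icc (t i) (t (i + 1))} := by
        intro m
        induction m with
        | zero => exact fun _ y hy => Or.inl (le_antisymm hy.2 hy.1)
        | succ m ih =>
          intro hm y hy
          rcases le_total y (t m) with h | h
          · exact ih (by omega) ⟨hy.1, h⟩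
          · exact Or.inr ⟨m, hm, h, hy.2⟩
      have hN : 0 < N := Nat.pos_of_ne_zero fun h => by
        rw [h, t0] at tN; exact zero_ne_one tN
      rintro _ ⟨y, hy, rfl⟩
      rw [← t0, ← tN] at hy
      rcases hcov N le_rfl hy with rfl | ⟨i, hi, hyi⟩
      · exact mem_iUnion₂.2 ⟨_, mem_cutPieces.2 ⟨0, hN, rfl⟩,
          mem_image_of_mem _ ⟨le_rfl, (ht 0 hN).le⟩⟩
      · exact mem_iUnion₂.2 ⟨_, mem_cutPieces.2 ⟨i, hi, rfl⟩, mem_image_of_mem _ hyi⟩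

/-- A quasicircle satisfying a separation bound with exponent at least `3` is weak chord-arc. -/
theorem isWeakChordArc_of_separationBound {Γ : Set Plane} {f : Plane ≃ₜ Plane} {H : ℝ} (hH : 1 ≤ H)
    (hw : ∀ x a b : Plane, dist x a ≤ dist x b → dist (f x) (f a) ≤ H * dist (f x) (f b))
    (hf : f '' Metric.sphere (0 : Plane) 1 = Γ) {r₀ β : ℝ} (hr₀ : 0 < r₀) (hβ : 3 ≤ β)
    (hsep : SeparationBound Γ r₀ β) : IsWeakChordArc Γ := by
  classical
  obtain ⟨C, hC, lam, hlam, hbound⟩ := hsep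
  have hΓc : IsCompact Γ := hf ▸ (isCompact_sphere _ _).image f.continuous
  have hH0 : 0 < H := by linarith
  -- Below `c` the separation bound applies with `δ = d ^ 2 / (4 * H)`: exponent `3` leaves a spare
  -- factor `d ≤ 1 / (4 * H * lam)`. Above `c` the cut points are `c ^ 2 / (4 * H)`-separated, and
  -- compactness bounds their number by `M`.
  set c := min r₀ (1 / (4 * H * lam)) with hc
  have hc0 : 0 < c := lt_min hr₀ (by positivity)
  obtain ⟨M, hM⟩ := exists_card_separated_le hΓc (s := c ^ 2 / (4 * H)) (by positivity)
  refine ⟨4 * H * C + M + 1, by positivity, fun Γ' hΓ' hsub hd1 => ?_⟩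
  obtain ⟨x, y, g, hgc, hginj, hgr, -, -⟩ := hΓ'
  set G : ℝ → Plane := fun u => g (projIcc 0 1 zero_le_one u) with hG
  have hGu : UniformContinuous G :=
    (CompactSpace.uniformContinuous_of_continuous hgc).comp
      (LipschitzWith.projIcc zero_le_one).uniformContinuous
  have hGc : Continuous G := hGu.continuous
  have hGinj : InjOn G (Icc 0 1) := fun u hu v hv h => by
    have := hginj h
    rw [projIcc_of_mem zero_le_one hu, projIcc_of_mem zero_le_one hv] at this
    exact congrArg Subtype.val this
  have hGr : G '' Icc 0 1 = Γ' := by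
    rw [← hgr]
    refine Subset.antisymm ?_ ?_
    · rintro _ ⟨u, _, rfl⟩; exact mem_range_self _
    · rintro _ ⟨u, rfl⟩
      exact ⟨u, u.2, by simp only [hG]; rw [projIcc_val]⟩
  set d := Metric.diam Γ' with hd
  have hd0 : 0 < d := by
    have h01 : G 0 ≠ G 1 := fun h => zero_ne_one (hGinj (by simp) (by simp) h)
    refine (dist_pos.2 h01).trans_le (Metric.dist_le_diam_of_mem ?_ ?_ ?_)
    · rw [← hGr]; exact isBounded_image_Icc hGc _ _
    · rw [← hGr]; exact mem_image_of_mem _ (by simp)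
    · rw [← hGr]; exact mem_image_of_mem _ (by simp)
  have hdd : d ^ 2 ≤ d := by nlinarith
  obtain ⟨N, hN, t, t0, tN, tm, td⟩ := exists_cuts hGu (e := d ^ 2) (by positivity) (a := 0) (by
    rw [hGr, ← hd]; nlinarith)
  have hpart := isPartition_cutPieces hGc hGinj t0 tN tm
  rw [hGr] at hpart
  refine ⟨cutPieces G t N, ⟨hpart, fun A hA => ?_⟩, ?_⟩
  · obtain ⟨i, hi, rfl⟩ := mem_cutPieces.1 hA
    have := td i hi
    rw [← hd]
    constructor <;> nlinarith
  have hnn : ∀ i ≤ N, 0 ≤ t i := fun i hi => by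
    rw [← t0]; exact monotone_cuts tm (Nat.zero_le _) hi
  have hle : ∀ i ≤ N, t i ≤ 1 := fun i hi => by
    rw [← tN]; exact monotone_cuts tm hi le_rfl
  have hGΓ : ∀ u ∈ Icc (0 : ℝ) 1, G u ∈ Γ' := fun u hu => hGr ▸ mem_image_of_mem _ hu
  have hsepd : ∀ i j, 1 ≤ i → i < j → j ≤ N → d ^ 2 / (4 * H) ≤ dist (G (t i)) (G (t j)) := by
    intro i j hi hij hj
    have h1 := le_dist_of_cuts hH hw hGc hGinj (d := d ^ 2 / 2) (r := t 1) (s := t i)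
      (r' := t (i + 1)) (t := t j) (fun u hu => hf ▸ hsub (hGΓ u hu))
      (hnn 1 hN) (monotone_cuts tm hi (by omega)) (tm i (by omega))
      (monotone_cuts tm hij hj) (hle j hj)
      (by have := (td 0 (by omega)).1; rwa [t0] at this) (td i (by omega)).1
    rw [div_le_iff₀ (by positivity)]
    linarith
  -- The cut `t 0` is left out because `le_dist_of_cuts` needs a full piece before the point; thus
  -- `N` is the number of points plus one.
  let T : Finset Plane := (Finset.Ico 1 N).image fun i => G (t i)
  have hTsep : ∀ p ∈ T, ∀ q ∈ T, p ≠ q → d ^ 2 / (4 * H) ≤ dist p q := by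
    intro p hp q hq hpq
    obtain ⟨i, hi, rfl⟩ := Finset.mem_image.1 hp
    obtain ⟨j, hj, rfl⟩ := Finset.mem_image.1 hq
    rw [Finset.mem_Ico] at hi hj
    rcases lt_trichotomy i j with h | rfl | h
    · exact hsepd i j hi.1 h hj.2.le
    · exact absurd rfl hpq
    · rw [dist_comm]; exact hsepd j i hj.1 h hi.2.le
  have hTcard : T.card = N - 1 := by
    rw [Finset.card_image_of_injOn, Nat.card_Ico]
    intro i hi j hj h
    rw [Finset.coe_Ico, mem_Ico] at hi hj
    have hpos : 0 < d ^ 2 / (4 * H) := by positivity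
    by_contra hne
    rcases lt_or_gt_of_ne hne with h' | h'
    · have := hsepd i j hi.1 h' hj.2.le
      simp only at h
      rw [h, dist_self] at this; linarith
    · have := hsepd j i hj.1 h' hi.2.le
      simp only at h
      rw [h, dist_self] at this; linarith
  have hTΓ' : ∀ p ∈ T, p ∈ Γ' := fun p hp => by
    obtain ⟨i, hi, rfl⟩ := Finset.mem_image.1 hp
    rw [Finset.mem_Ico] at hi
    exact hGΓ _ ⟨hnn i hi.2.le, hle i hi.2.le⟩
  have hTΓ : (T : Set Plane) ⊆ Γ := fun p hp => hsub (hTΓ' p hp)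
  have hNT : (N : ℝ) = T.card + 1 := by
    rw [hTcard, Nat.cast_sub hN]; simp
  have hNd : N * d ≤ 4 * H * C + M + 1 := by
    rcases le_or_gt d c with hdc | hcd
    · have h2 : lam * d ^ β ≤ d ^ 2 / (4 * H) := by
        have h3 : d ^ β ≤ d ^ (3 : ℝ) := Real.rpow_le_rpow_of_exponent_ge hd0 hd1.le hβ
        have h3' : d ^ (3 : ℝ) = d ^ 3 := by exact_mod_cast Real.rpow_natCast d 3
        rw [h3'] at h3
        have h4 : d * (4 * H * lam) ≤ 1 :=
          (le_div_iff₀ (by positivity)).1 (hdc.trans (min_le_right _ _))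
        rw [le_div_iff₀ (by positivity)]
        calc lam * d ^ β * (4 * H) ≤ lam * d ^ 3 * (4 * H) := by gcongr
          _ = d ^ 2 * (d * (4 * H * lam)) := by ring
          _ ≤ d ^ 2 * 1 := by gcongr
          _ = d ^ 2 := mul_one _
      have h5 : d ^ 2 / (4 * H) ≤ d := (div_le_self (by positivity) (by linarith)).trans hdd
      have h6 := hbound (G 0) d (d ^ 2 / (4 * H)) hd0 (hdc.trans (min_le_left _ _)) (by positivity)
        h2 h5 T hTΓ (fun p hp => Metric.dist_le_diam_of_mem
          (by rw [← hGr]; exact isBounded_image_Icc hGc _ _) (hTΓ' p hp) (hGΓ 0 (by simp))) hTsep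
      have h7 : C * (d / (d ^ 2 / (4 * H))) * d = 4 * H * C := by field_simp
      have h8 : (T.card : ℝ) * d ≤ 4 * H * C := h7 ▸ mul_le_mul_of_nonneg_right h6 hd0.le
      rw [hNT, add_mul, one_mul]
      have : (0 : ℝ) ≤ M := Nat.cast_nonneg M
      linarith
    · have h2 : T.card ≤ M := hM T hTΓ fun p hp q hq hpq => by
        refine le_trans ?_ (hTsep p hp q hq hpq)
        gcongr
      have h3 : (T.card : ℝ) ≤ M := by exact_mod_cast h2
      have h4 : (0 : ℝ) ≤ T.card := Nat.cast_nonneg _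
      have h5 : 0 < 4 * H * C := by positivity
      rw [hNT]
      nlinarith
  unfold chordArcIndex
  rw [← hd]
  have hsum : ∑ A ∈ cutPieces G t N, Metric.diam A ≤ N * d ^ 2 := by
    have h1 : ∑ A ∈ cutPieces G t N, Metric.diam A ≤ (cutPieces G t N).card • d ^ 2 :=
      Finset.sum_le_card_nsmul _ _ _ fun A hA => by
        obtain ⟨i, hi, rfl⟩ := mem_cutPieces.1 hA
        exact (td i hi).2
    rw [nsmul_eq_mul] at h1
    refine h1.trans (mul_le_mul_of_nonneg_right ?_ (by positivity))
    exact_mod_cast card_cutPieces_le G t N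
  refine le_trans ?_ hNd
  calc 1 / d * _ ≤ 1 / d * (N * d ^ 2) := mul_le_mul_of_nonneg_left hsum (by positivity)
    _ = N * d := by field_simp

theorem levelSet_zero {Ω : Set Plane} (hfr : (frontier Ω).Nonempty) :
    levelSet Ω 0 = frontier Ω := by
  ext x
  refine ⟨fun h => ?_, fun h => ⟨frontier_subset_closure h, Metric.infDist_zero_of_mem h⟩⟩
  exact (isClosed_frontier.mem_iff_infDist_zero hfr).2 h.2

end DoubleDome

theorem proposition4p4 (Ω : Set DoubleDome.Plane) (α : ℝ)
    (hΩ : DoubleDome.IsJordanDomain Ω)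
    (hLQC : DoubleDome.HasLQC Ω)
    (hα₀ : 0 < α) (hα₁ : α < 1)
    (hqs : DoubleDome.IsQuasisymmetricTo (DoubleDome.surface Ω α)
      (Metric.sphere (0 : DoubleDome.Space) 1)) :
    DoubleDome.IsWeakChordArc (frontier Ω) := by
  obtain ⟨hΩo, hΩconn, hΩb, γ, -, -, hγ⟩ := hΩ
  have hfr : (frontier Ω).Nonempty := by rw [← hγ]; exact range_nonempty γ
  obtain ⟨ε₀, hε₀, K, -, hK⟩ := hLQC
  obtain ⟨f, hfK, hf⟩ := hK 0 le_rfl hε₀.le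
  rw [DoubleDome.levelSet_zero hfr] at hf
  obtain ⟨H, hH, hw⟩ := hfK.weak_quasisymmetric
  obtain ⟨R₀, hR₀, hcork⟩ := DoubleDome.exists_corkscrew hΩo hΩconn.nonempty hΩb f hf hH hw
  obtain ⟨r₀, hr₀, hsep⟩ := DoubleDome.exists_separationBound hα₀ hΩo hfr hH hR₀ hcork hqs
  -- This is where `α < 1` enters: the powers of `1 / α` are unbounded.
  obtain ⟨k, hk⟩ := pow_unbounded_of_one_lt 3 ((one_lt_div hα₀).2 hα₁)
  have hk3 : 3 ≤ (1 / α) ^ (k + 1) := hk.le.trans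
    (pow_le_pow_right₀ ((one_lt_div hα₀).2 hα₁).le (Nat.le_succ k))
  exact DoubleDome.isWeakChordArc_of_separationBound hH hw hf hr₀ hk3
    (hsep.pow (by positivity) k)
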